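/- Let $\gamma>0$ and let $\mathbf U:\mathbb T^2\to\mathbb R$ be one of the two prototypes $$\mathbf U(x_1,x_2)=\big(2-\sin(2\pi x_1)-\sin(2\pi x_2)\big)^\gamma \quad (\mathcal A_1)\qquad\text{or}\qquad \mathbf U(x_1,x_2)=\big(2-\cos(2\pi x_1)-\cos(2\pi x_2)\big)^\gamma\quad(\mathcal A_2).$$ Let $\xi=(\xi_1,\xi_2)\in\mathbb R^2$ be non-resonant ($\kappa\cdot\xi\ne0$ for all $\kappa\in\mathbb Z^2\setminus\{0\}$), and $H(x,p)=\tfrac12|p|^2-\mathbf U(\xi_1x,\xi_2x)$ for $(x,p)\in\mathbb R\times\mathbb R$. For each $p\in\mathbb R$ there is a unique constant $\overline H(p)$ such that for every $\delta>0$ there is a bounded, Lipschitz (and uniformly continuous) viscosity solution $w_\delta$ of $\overline H(p)-\delta\le H(x,p+w_\delta'(x))\le\overline H(p)+\delta$ in $\mathbb R$; this defines the effective Hamiltonian $\overline H$. Put $p_0=\int_{\mathbb T^2}(2\mathbf U)^{1/2}\,d\mathbf x$. The function $\overline H$ is differentiable on $[p_0,\infty)$ (one-sidedly at $p_0$) and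 $\mathrm C^2$ on $(p_0,\infty)$; $\overline H'(p_0)$ denotes the right derivative $\overline H'_+(p_0)$. (i) $\overline H\in \mathrm C^1(\mathbb R)$ if and only if $\gamma\ge2$. Moreover there are positive constants $C_1$ and, for each $M$, $C_2=C_2(M)$, such that - if $\gamma>2$: $C_1\overline H(p)^{\frac12-\frac1\gamma}\le\overline H'(p)\le C_2\overline H(p)^{\frac12-\frac1\gamma}$ for $p_0\le p\le M$; - if $\gamma=2$: $\overline H'(p_0)=0$ and $C_1(1+|\log\overline H(p)|)^{-1}\le\overline H'(p)\le C_2(1+|\log\overline H(p)|)^{-1}$ for $p_0<p\le M$; and if $\overline H(M)<1$ there are $c_1,c_2>0$, depending on $M$, with $c_1|\log\overline H(p)|^{-1}\le\overline H'(p)\le c_2|\log\overline H(p)|^{-1}$ for $p_0<p\le M$; - if $0<\gamma<2$: $C_1\le\overline H'(p)\le C_2$ for $p_0\le p\le M$. (ii) $\overline H\notin \mathrm C^2(\mathbb R)$ for every $\gamma>0$. Moreover there are positive constants $C_1$ and, for each $M$, $C_2=C_2(M)$, such that for $p_0<p\le M$ - if $\gamma>2$: $C_1\overline H(p)^{-\frac2\gamma}\le\overline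 H''(p)\le C_2\overline H(p)^{-\frac2\gamma}$; - if $\gamma=2$: $C_1\big(\overline H(p)(1+|\log\overline H(p)|)^3\big)^{-1}\le\overline H''(p)\le C_2\big(\overline H(p)(1+|\log\overline H(p)|)^3\big)^{-1}$; and if $\overline H(M)<1$ there are $c_1,c_2>0$, depending on $M$, with $c_1\big(\overline H(p)|\log\overline H(p)|^3\big)^{-1}\le\overline H''(p)\le c_2\big(\overline H(p)|\log\overline H(p)|^3\big)^{-1}$; - if $\frac23<\gamma<2$: $C_1\overline H(p)^{\frac1\gamma-\frac32}\le\overline H''(p)\le C_2\overline H(p)^{\frac1\gamma-\frac32}$; - if $\gamma=\frac23$: $C_1(1+|\log\overline H(p)|)\le\overline H''(p)\le C_2(1+|\log\overline H(p)|)$, where here $C_2$ is independent of $M$ and $C_1$ may depend on $M$; - if $0<\gamma<\frac23$: $C_1\le\overline H''(p)\le C_2$ for all $p>p_0$, with both constants independent of $M$. -/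

import Mathlib

/-- `(ξ₁, ξ₂)` is non-resonant: `κ · ξ ≠ 0` for every `κ ∈ ℤ² \ {0}`. -/
def NonResonant (ξ₁ ξ₂ : ℝ) : Prop :=
  ∀ k l : ℤ, (k, l) ≠ (0, 0) → (k : ℝ) * ξ₁ + (l : ℝ) * ξ₂ ≠ 0

/-- First prototype, as a `ℤ²`-periodic function on `ℝ²`. -/
noncomputable def sinPrototype (γ : ℝ) (x y : ℝ) : ℝ :=
  (2 - Real.sin (2 * Real.pi * x) - Real.sin (2 * Real.pi * y)) ^ γ

/-- Second prototype, as a `ℤ²`-periodic function on `ℝ²`. -/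
noncomputable def cosPrototype (γ : ℝ) (x y : ℝ) : ℝ :=
  (2 - Real.cos (2 * Real.pi * x) - Real.cos (2 * Real.pi * y)) ^ γ

/-- `H(x,p) = |p|²/2 + V(x)` with the quasi-periodic potential `V(x) = -U(ξ₁ x, ξ₂ x)`. -/
noncomputable def mechHamiltonian (U : ℝ → ℝ → ℝ) (ξ₁ ξ₂ : ℝ) (x p : ℝ) : ℝ :=
  p ^ 2 / 2 - U (ξ₁ * x) (ξ₂ * x)

/-- `w` is a viscosity subsolution of `H(x, p + w') ≤ c` on `ℝ`. -/
def IsViscositySubsolution (H : ℝ → ℝ → ℝ) (p c : ℝ) (w : ℝ → ℝ) : Prop :=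
  ∀ φ : ℝ → ℝ, ContDiff ℝ 1 φ → ∀ x : ℝ, IsLocalMax (fun y => w y - φ y) x →
    H x (p + deriv φ x) ≤ c

/-- `w` is a viscosity supersolution of `H(x, p + w') ≥ c` on `ℝ`. -/
def IsViscositySupersolution (H : ℝ → ℝ → ℝ) (p c : ℝ) (w : ℝ → ℝ) : Prop :=
  ∀ φ : ℝ → ℝ, ContDiff ℝ 1 φ → ∀ x : ℝ, IsLocalMin (fun y => w y - φ y) x →
    c ≤ H x (p + deriv φ x)

/-- For every `δ > 0` the approximate cell problem `c - δ ≤ H(x, p + w') ≤ c + δ` in `ℝ`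
has a viscosity solution `w` that is bounded, uniformly continuous and Lipschitz. -/
def IsEffectiveConstant (H : ℝ → ℝ → ℝ) (p c : ℝ) : Prop :=
  ∀ δ : ℝ, 0 < δ → ∃ w : ℝ → ℝ,
    (∃ B : ℝ, ∀ x, |w x| ≤ B) ∧ UniformContinuous w ∧ (∃ K : NNReal, LipschitzWith K w) ∧
    IsViscositySubsolution H p (c + δ) w ∧ IsViscositySupersolution H p (c - δ) w

/-- The effective Hamiltonian: `effectiveHamiltonian H p` is the constant `c` for which all
approximate cell problems are solvable (the value is arbitrary if there is no such `c`). -/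
noncomputable def effectiveHamiltonian (H : ℝ → ℝ → ℝ) (p : ℝ) : ℝ :=
  Classical.epsilon (fun c : ℝ => IsEffectiveConstant H p c)

/-- `∫_{𝕋²} (2 U)^{1/2}`, the integral over the torus being the one over the unit square. -/
noncomputable def criticalMomentum (U : ℝ → ℝ → ℝ) : ℝ :=
  ∫ x in (0 : ℝ)..1, ∫ y in (0 : ℝ)..1, Real.sqrt (2 * U x y)

open Filter Topology MeasureTheory

/-! On the line, an equation `|p + w'| ^ 2 / 2 - V = c` with `V ≥ 0` prescribes `|p + w'| = √(2 * (V
+ c))`, so a bounded corrector without kinks exists (approximately) exactly when the mean `G c` of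
this root is `|p|`. If `|p| < G 0`, the level is `0`, and kinks of `w` are placed where `V` is
almost `0`, where the supersolution inequality costs almost nothing. Hence the effective Hamiltonian
vanishes for `|p| ≤ G 0` and inverts `G` beyond (`isEffectiveConstant_iff`). Necessity comes from
coercive test functions built from an approximation of the root whose primitive is linear up to a
bounded error.

Such approximations exist by unique ergodicity (`hasApproxMean_comp`): by non-resonance each
nonconstant character has a bounded primitive along the line, and Weierstrass approximation reduces
the root to a trigonometric polynomial.

Both prototypes are `v ^ γ`, where `v` has the law of `2 - cos - cos` on the torus. Its minimum is a
nondegenerate quadratic one in dimension two, so `[0, t]` has mass comparable to `t`, and integrals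
of nonnegative decreasing functions against the law are comparable to Lebesgue integrals over `[0,
4]`.

Write `m_α(c)` for the mean of `(t ^ γ + c) ^ (-α)`. Differentiating the inverse of `G` gives `H' =
√2 / m_{1/2}(H)` and `H'' = m_{3/2}(H) / m_{1/2}(H) ^ 3`. Since `m_α(c)` is comparable to `∫ (t + c
^ (1/γ)) ^ (-αγ)` over `[0, 4]`, it behaves near `c = 0` like a power, a logarithm or a constant
according to whether `αγ` is above, equal to or below `1`. This produces the thresholds `γ = 2` (for
`α = 1/2`) and `γ = 2/3` (for `α = 3/2`). Jensen gives `H'' ≥ 1`, which excludes `C²` across the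
edge of the flat part and, with an upper bound of `H''` for `H ≥ 1`, makes some of the constants
independent of `M`. -/

/-- `f` stays, up to arbitrarily small errors, in the class of continuous functions whose primitive
is at bounded distance from `x ↦ m * x`. -/
def HasApproxMean (f : ℝ → ℝ) (m : ℝ) : Prop :=
  ∀ ε : ℝ, 0 < ε → ∃ q : ℝ → ℝ, Continuous q ∧ (∀ x, |q x - f x| ≤ ε) ∧
    ∃ B : ℝ, ∀ x, |(∫ t in (0 : ℝ)..x, q t) - m * x| ≤ B

/-- The sublevel sets `{V ≤ δ}`, `δ > 0`, are relatively dense. -/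
def Recurrent (V : ℝ → ℝ) : Prop :=
  ∀ δ : ℝ, 0 < δ → ∃ L : ℝ, ∀ x, ∃ y, x ≤ y ∧ y ≤ x + L ∧ V y ≤ δ

/-! ### Viscosity inequalities tested against coercive functions -/

theorem exists_forall_sub_le {w φ : ℝ → ℝ} (hw : Continuous w) {B : ℝ} (hB : ∀ x, |w x| ≤ B)
    (hφ : Continuous φ) (hlim : Tendsto φ (cocompact ℝ) atTop) :
    ∃ x, ∀ y, w y - φ y ≤ w x - φ x := by
  have hlim' : Tendsto (fun y => φ y - w y) (cocompact ℝ) atTop := by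
    refine tendsto_atTop_mono (f := fun y => φ y + -B) (fun y => ?_)
      (tendsto_atTop_add_const_right _ _ hlim)
    have := (abs_le.1 (hB y)).2
    linarith
  obtain ⟨x, hx⟩ := (hφ.sub hw).exists_forall_le hlim'
  exact ⟨x, fun y => by have h : φ x - w x ≤ φ y - w y := hx y; linarith⟩

theorem exists_forall_le_sub {w φ : ℝ → ℝ} (hw : Continuous w) {B : ℝ} (hB : ∀ x, |w x| ≤ B)
    (hφ : Continuous φ) (hlim : Tendsto φ (cocompact ℝ) atBot) :
    ∃ x, ∀ y, w x - φ x ≤ w y - φ y := by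
  obtain ⟨x, hx⟩ := exists_forall_sub_le hw.neg (B := B) (by simpa using hB) hφ.neg
    (tendsto_neg_atBot_atTop.comp hlim)
  exact ⟨x, fun y => by have := hx y; simp only [Pi.neg_apply] at this; linarith⟩

theorem hasDerivAt_primitive {g : ℝ → ℝ} (hg : Continuous g) (x : ℝ) :
    HasDerivAt (fun x => ∫ t in (0 : ℝ)..x, g t) (g x) x :=
  intervalIntegral.integral_hasDerivAt_right (hg.intervalIntegrable _ _)
    (hg.stronglyMeasurableAtFilter _ _) hg.continuousAt

section Viscosity

variable {V : ℝ → ℝ} {p a m : ℝ} {w : ℝ → ℝ}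

theorem contDiff_one_of_hasDerivAt {φ g : ℝ → ℝ} (hφ : ∀ x, HasDerivAt φ (g x) x)
    (hg : Continuous g) : ContDiff ℝ 1 φ := by
  rw [contDiff_one_iff_deriv]
  refine ⟨fun x => (hφ x).differentiableAt, ?_⟩
  have : deriv φ = g := funext fun x => (hφ x).deriv
  rwa [this]

/-- A bounded function minus a coercive one attains its maximum. So a single coercive test function
violating the inequality everywhere refutes a bounded subsolution. -/
theorem IsViscositySubsolution.exists_le
    (h : IsViscositySubsolution (fun x q => q ^ 2 / 2 - V x) p a w)
    (hw : Continuous w) {B : ℝ} (hB : ∀ x, |w x| ≤ B) {φ g : ℝ → ℝ}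
    (hφ : ∀ x, HasDerivAt φ (g x) x) (hg : Continuous g)
    (hlim : Tendsto φ (cocompact ℝ) atTop) :
    ∃ x, (p + g x) ^ 2 / 2 - V x ≤ a := by
  have hφ1 := contDiff_one_of_hasDerivAt hφ hg
  obtain ⟨x, hx⟩ := exists_forall_sub_le hw hB hφ1.continuous hlim
  have := h _ hφ1 x (Eventually.of_forall hx)
  rw [(hφ x).deriv] at this
  exact ⟨x, this⟩

theorem IsViscositySupersolution.exists_ge
    (h : IsViscositySupersolution (fun x q => q ^ 2 / 2 - V x) p a w)
    (hw : Continuous w) {B : ℝ} (hB : ∀ x, |w x| ≤ B) {φ g : ℝ → ℝ}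
    (hφ : ∀ x, HasDerivAt φ (g x) x) (hg : Continuous g)
    (hlim : Tendsto φ (cocompact ℝ) atBot) :
    ∃ x, a ≤ (p + g x) ^ 2 / 2 - V x := by
  have hφ1 := contDiff_one_of_hasDerivAt hφ hg
  obtain ⟨x, hx⟩ := exists_forall_le_sub hw hB hφ1.continuous hlim
  have := h _ hφ1 x (Eventually.of_forall hx)
  rw [(hφ x).deriv] at this
  exact ⟨x, this⟩

/-- A steep parabola touches `w` near a point where `V` is small, and there the Hamiltonian is at
least `-V`. -/
theorem IsViscositySubsolution.nonneg
    (h : IsViscositySubsolution (fun x q => q ^ 2 / 2 - V x) p a w)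
    (hw : Continuous w) {B : ℝ} (hB : ∀ x, |w x| ≤ B) (hV : Continuous V) (hrec : Recurrent V) :
    0 ≤ a := by
  by_contra! ha
  obtain ⟨L, hL⟩ := hrec (-a / 2) (by linarith)
  obtain ⟨x₀, -, -, hx₀⟩ := hL 0
  obtain ⟨r, hr, hball⟩ := Metric.eventually_nhds_iff.1
    (hV.continuousAt.eventually_lt_const (show V x₀ < -a by linarith))
  have hB0 : 0 ≤ B := (abs_nonneg _).trans (hB 0)
  -- `N * r ^ 2` exceeds the oscillation `2 * B` of `w`, which confines the maximum to the ball of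
  -- radius `r`.
  set N : ℝ := (2 * B + 1) / r ^ 2 with hN
  have hN0 : 0 < N := by positivity
  have hφ : ContDiff ℝ 1 fun y : ℝ => N * (y - x₀) ^ 2 := by fun_prop
  have hlim : Tendsto (fun y : ℝ => N * (y - x₀) ^ 2) (cocompact ℝ) atTop := by
    refine Tendsto.const_mul_atTop hN0 ?_
    have h1 : Tendsto (fun y : ℝ => dist y x₀) (cocompact ℝ) atTop := by
      simpa [dist_comm] using tendsto_dist_left_cocompact_atTop x₀
    have := (tendsto_pow_atTop (α := ℝ) two_ne_zero).comp h1
    refine this.congr fun y => ?_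
    simp [Real.dist_eq]
  obtain ⟨x, hx⟩ := exists_forall_sub_le hw hB hφ.continuous hlim
  have h1 := h _ hφ x (Eventually.of_forall hx)
  have h2 := hx x₀
  have h3 := abs_le.1 (hB x)
  have h4 := abs_le.1 (hB x₀)
  have h5 : N * (x - x₀) ^ 2 < N * r ^ 2 := by
    have : N * r ^ 2 = 2 * B + 1 := by rw [hN]; field_simp
    rw [this]
    have : N * (x₀ - x₀) ^ 2 = 0 := by simp
    linarith
  have h6 : |x - x₀| < r := abs_lt_of_sq_lt_sq (lt_of_mul_lt_mul_left h5 hN0.le) hr.le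
  have h7 := hball (y := x) (by rwa [Real.dist_eq])
  have h8 := sq_nonneg (p + deriv (fun y : ℝ => N * (y - x₀) ^ 2) x)
  simp only at h1
  linarith

theorem tendsto_cocompact_atTop_of_abs_le {φ : ℝ → ℝ} {k C : ℝ} (hk : 0 < k)
    (h : ∀ x, k * |x| - C ≤ φ x) : Tendsto φ (cocompact ℝ) atTop := by
  refine tendsto_atTop_mono h ?_
  have h1 : Tendsto (fun x : ℝ => |x|) (cocompact ℝ) atTop := tendsto_norm_cocompact_atTop
  exact tendsto_atTop_add_const_right _ (-C) (h1.const_mul_atTop hk)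

theorem exists_sign (p : ℝ) : ∃ σ : ℝ, σ ^ 2 = 1 ∧ p = σ * |p| := by
  rcases le_total 0 p with h | h
  · exact ⟨1, by norm_num, by rw [abs_of_nonneg h, one_mul]⟩
  · exact ⟨-1, by norm_num, by rw [abs_of_nonpos h]; ring⟩

theorem abs_of_sq_eq_one {σ : ℝ} (h : σ ^ 2 = 1) : |σ| = 1 := by
  have h1 : |σ| ^ 2 = 1 := by rw [sq_abs, h]
  exact (pow_eq_one_iff_of_nonneg (abs_nonneg σ) two_ne_zero).1 h1

theorem IsViscositySubsolution.abs_le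
    (h : IsViscositySubsolution (fun x q => q ^ 2 / 2 - V x) p a w)
    (hw : Continuous w) {B : ℝ} (hB : ∀ x, |w x| ≤ B) (ha : 0 ≤ a) (hV0 : ∀ x, 0 ≤ V x)
    (hm : HasApproxMean (fun x => √(2 * (V x + a))) m) : |p| ≤ m := by
  by_contra! hlt
  set ε := (|p| - m) / 4 with hε
  have hε0 : 0 < ε := by linarith
  obtain ⟨q, hq, hqs, C, hC⟩ := hm ε hε0
  obtain ⟨σ, hσ, hp⟩ := exists_sign p
  have hσ1 := abs_of_sq_eq_one hσ
  -- Here `p + φ'` equals `σ * (q + 2ε + 4ε exp (σx))`, of modulus above the root everywhere. As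
  -- `|p| = m + 4ε`, the part without the exponential behaves like `-2εσx`: it grows as `σx → -∞`,
  -- and the exponential takes over as `σx → +∞`.
  refine absurd (h.exists_le hw hB
    (φ := fun x => σ * ((∫ t in (0 : ℝ)..x, q t) + 2 * ε * x) - p * x + 4 * ε * Real.exp (σ * x))
    (g := fun x => σ * (q x + 2 * ε * 1) - p * 1 + 4 * ε * (Real.exp (σ * x) * (σ * 1)))
    (fun x => ((((hasDerivAt_primitive hq x).add ((hasDerivAt_id x).const_mul (2 * ε))).const_mul
        σ).sub ((hasDerivAt_id x).const_mul p)).add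
        ((((hasDerivAt_id x).const_mul σ).exp).const_mul (4 * ε)))
    (by fun_prop) (tendsto_cocompact_atTop_of_abs_le (k := 2 * ε) (C := C) (by positivity) ?_)) ?_
  rotate_left
  · rintro ⟨x, hx⟩
    have h1 := _root_.abs_le.1 (hqs x)
    have h2 := Real.sqrt_nonneg (2 * (V x + a))
    have h3 := Real.exp_pos (σ * x)
    have h4 : √(2 * (V x + a)) ^ 2 = 2 * (V x + a) :=
      Real.sq_sqrt (by have := hV0 x; positivity)
    have h5 : √(2 * (V x + a)) < q x + 2 * ε + 4 * ε * Real.exp (σ * x) := by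
      have : 0 < 4 * ε * Real.exp (σ * x) := by positivity
      linarith
    have h6 : (p + (σ * (q x + 2 * ε * 1) - p * 1 + 4 * ε * (Real.exp (σ * x) * (σ * 1)))) ^ 2
        = (q x + 2 * ε + 4 * ε * Real.exp (σ * x)) ^ 2 := by
      linear_combination (q x + 2 * ε + 4 * ε * Real.exp (σ * x)) ^ 2 * hσ
    rw [h6] at hx
    have h7 := pow_lt_pow_left₀ h5 h2 two_ne_zero
    linarith
  · intro x
    have h1 : |σ * ((∫ t in (0 : ℝ)..x, q t) - m * x)| ≤ C := by
      rw [abs_mul, hσ1, one_mul]; exact hC x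
    have h2 := (_root_.abs_le.1 h1).1
    have h3 : 4 * ε * (σ * x + 1) ≤ 4 * ε * Real.exp (σ * x) :=
      mul_le_mul_of_nonneg_left (Real.add_one_le_exp _) (by positivity)
    have h3' : 0 ≤ 4 * ε * Real.exp (σ * x) := by positivity
    have h4 : |x| = |σ * x| := by rw [abs_mul, hσ1, one_mul]
    have h5 : p = σ * (m + 4 * ε) := by rw [hp, hε]; ring
    have h6 : σ * ((∫ t in (0 : ℝ)..x, q t) + 2 * ε * x) - p * x
        = σ * ((∫ t in (0 : ℝ)..x, q t) - m * x) - 2 * ε * (σ * x) := by rw [h5]; ring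
    rw [h6, h4]
    rcases abs_cases (σ * x) with ⟨h, -⟩ | ⟨h, -⟩ <;> rw [h] <;> nlinarith

theorem IsViscositySupersolution.le_abs
    (h : IsViscositySupersolution (fun x q => q ^ 2 / 2 - V x) p a w)
    (hw : Continuous w) {B : ℝ} (hB : ∀ x, |w x| ≤ B) (ha : 0 < a) (hV0 : ∀ x, 0 ≤ V x)
    (hm : HasApproxMean (fun x => √(2 * (V x + a))) m) : m ≤ |p| := by
  by_contra! hlt
  -- The first bound keeps the mean `m - 2ε` of `r` above `|p|`. The second, available since `a >
  -- 0`, keeps `r = q - 2ε` above minus the root.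
  set ε := min ((m - |p|) / 4) (√(2 * a) / 4) with hε
  have hsa : 0 < √(2 * a) := Real.sqrt_pos.2 (by positivity)
  have hε0 : 0 < ε := lt_min (by linarith) (by linarith)
  have hε1 : ε ≤ (m - |p|) / 4 := min_le_left _ _
  have hε2 : ε ≤ √(2 * a) / 4 := min_le_right _ _
  obtain ⟨q, hq, hqs, C, hC⟩ := hm ε hε0
  set r : ℝ → ℝ := fun x => q x - 2 * ε with hr
  have hrc : Continuous r := by fun_prop
  have hrint : ∀ x, |(∫ t in (0 : ℝ)..x, r t) - (m - 2 * ε) * x| ≤ C := by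
    intro x
    have : (∫ t in (0 : ℝ)..x, r t) = (∫ t in (0 : ℝ)..x, q t) - 2 * ε * x := by
      rw [hr, intervalIntegral.integral_sub (hq.intervalIntegrable _ _)
        (continuous_const.intervalIntegrable _ _), intervalIntegral.integral_const]
      simp; ring
    rw [this]
    convert hC x using 2
    ring
  -- A continuous switch from `1` to `-1`: the primitive of `θ * r` bends down on both sides, faster
  -- than `p * x` can compensate, while `|θ * r|` stays below the root.
  set θ : ℝ → ℝ := fun x => max (-1) (min 1 (-x)) with hθ
  have hθc : Continuous θ := by fun_prop
  have hθ1 : ∀ x, |θ x| ≤ 1 := fun x =>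
    _root_.abs_le.2 ⟨le_max_left _ _, max_le (by norm_num) (min_le_left _ _)⟩
  have hθr : Continuous fun x => θ x * r x := hθc.mul hrc
  refine absurd (h.exists_ge hw hB
    (φ := fun x => (∫ t in (0 : ℝ)..x, θ t * r t) - p * x)
    (g := fun x => θ x * r x - p * 1)
    (fun x => (hasDerivAt_primitive hθr x).sub ((hasDerivAt_id x).const_mul p))
    (by fun_prop) ?_) ?_
  rotate_left
  · rintro ⟨x, hx⟩
    have h1 := _root_.abs_le.1 (hqs x)
    have h4 : √(2 * (V x + a)) ^ 2 = 2 * (V x + a) :=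
      Real.sq_sqrt (by have := hV0 x; positivity)
    have h5 : √(2 * a) ≤ √(2 * (V x + a)) := Real.sqrt_le_sqrt (by linarith [hV0 x])
    have h6 : |r x| < √(2 * (V x + a)) := by
      rw [abs_lt, hr]
      constructor <;> simp only <;> linarith
    have h7 : |θ x * r x| < √(2 * (V x + a)) := by
      rw [abs_mul]
      refine lt_of_le_of_lt ?_ h6
      exact mul_le_of_le_one_left (abs_nonneg _) (hθ1 x)
    have h8 : (θ x * r x) ^ 2 < 2 * (V x + a) := by
      rw [← h4, ← sq_abs (θ x * r x)]
      exact pow_lt_pow_left₀ h7 (abs_nonneg _) two_ne_zero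
    have h9 : p + (θ x * r x - p * 1) = θ x * r x := by ring
    rw [h9] at hx
    linarith
  · have hp := abs_le.1 (le_refl |p|)
    rw [cocompact_eq_atBot_atTop, tendsto_sup]
    have hint : ∀ x y, IntervalIntegrable (fun t => θ t * r t) volume x y :=
      fun x y => hθr.intervalIntegrable _ _
    have hint' : ∀ x y, IntervalIntegrable r volume x y := fun x y => hrc.intervalIntegrable _ _
    constructor
    · have hlin : Tendsto (fun x : ℝ => ε * x + ((∫ t in (0 : ℝ)..(-1), θ t * r t)
          - (∫ t in (0 : ℝ)..(-1), r t) + C)) atBot atBot :=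
        tendsto_atBot_add_const_right _ _ (tendsto_id.const_mul_atBot hε0)
      refine tendsto_atBot_mono' _ ?_ hlin
      filter_upwards [eventually_le_atBot (-1)] with x hx
      have e1 : (∫ t in (-1)..x, θ t * r t) = ∫ t in (-1)..x, r t := by
        refine intervalIntegral.integral_congr fun t ht => ?_
        rw [Set.uIcc_of_ge hx] at ht
        have : θ t = 1 := by
          simp only [hθ]
          rw [min_eq_left (by linarith [ht.2]), max_eq_right (by norm_num)]
        simp [this]
      have e2 := intervalIntegral.integral_add_adjacent_intervals (hint 0 (-1)) (hint (-1) x)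
      have e3 := intervalIntegral.integral_add_adjacent_intervals (hint' 0 (-1)) (hint' (-1) x)
      have e4 := (_root_.abs_le.1 (hrint x)).2
      nlinarith
    · have hlin : Tendsto (fun x : ℝ => (-ε) * x + ((∫ t in (0 : ℝ)..1, θ t * r t)
          + (∫ t in (0 : ℝ)..1, r t) + C)) atTop atBot :=
        tendsto_atBot_add_const_right _ _ (tendsto_id.const_mul_atTop_of_neg (by linarith))
      refine tendsto_atBot_mono' _ ?_ hlin
      filter_upwards [eventually_ge_atTop 1] with x hx
      have e1 : (∫ t in (1)..x, θ t * r t) = -∫ t in (1)..x, r t := by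
        rw [← intervalIntegral.integral_neg]
        refine intervalIntegral.integral_congr fun t ht => ?_
        rw [Set.uIcc_of_le hx] at ht
        have : θ t = -1 := by
          simp only [hθ]
          rw [min_eq_right (by linarith [ht.1]), max_eq_left (by linarith [ht.1])]
        simp [this]
      have e2 := intervalIntegral.integral_add_adjacent_intervals (hint 0 1) (hint 1 x)
      have e3 := intervalIntegral.integral_add_adjacent_intervals (hint' 0 1) (hint' 1 x)
      have e4 := (_root_.abs_le.1 (hrint x)).1
      nlinarith

/-- The corrector is the primitive of `±q` minus `p * x`. It is bounded because `q` has mean `|p|`,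
and `C¹`, so touching test functions share its derivative. Factoring `q² - s²`, with `s` the root,
bounds the error by `ε * (S + 1)`. -/
theorem isEffectiveConstant_of_hasApproxMean {c K : ℝ} (hc : 0 ≤ c) (hV0 : ∀ x, 0 ≤ V x)
    (hVK : ∀ x, V x ≤ K) (hm : HasApproxMean (fun x => √(2 * (V x + c))) |p|) :
    IsEffectiveConstant (fun x q => q ^ 2 / 2 - V x) p c := by
  intro δ hδ
  set S := √(2 * (K + c)) with hS
  have hS0 : 0 ≤ S := Real.sqrt_nonneg _
  set ε := min 1 (δ / (S + 1)) with hε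
  have hε0 : 0 < ε := lt_min one_pos (by positivity)
  have hε1 : ε ≤ 1 := min_le_left _ _
  have hε2 : ε * (S + 1) ≤ δ := by
    have : ε ≤ δ / (S + 1) := min_le_right _ _
    rwa [le_div_iff₀ (by positivity)] at this
  obtain ⟨q, hq, hqs, C, hC⟩ := hm ε hε0
  obtain ⟨σ, hσ, hp⟩ := exists_sign p
  have hσ1 := abs_of_sq_eq_one hσ
  set w : ℝ → ℝ := fun x => σ * (∫ t in (0 : ℝ)..x, q t) - p * x with hw
  have hwd : ∀ x, HasDerivAt w (σ * q x - p * 1) x := fun x =>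
    ((hasDerivAt_primitive hq x).const_mul σ).sub ((hasDerivAt_id x).const_mul p)
  have hsS : ∀ x, √(2 * (V x + c)) ≤ S := fun x => Real.sqrt_le_sqrt (by linarith [hVK x])
  have hqS : ∀ x, |q x| ≤ S + 1 := fun x => by
    have h1 := _root_.abs_le.1 (hqs x)
    have h2 := Real.sqrt_nonneg (2 * (V x + c))
    rw [_root_.abs_le]
    constructor <;> linarith [hsS x]
  have hlip : LipschitzWith (S + 1 + |p|).toNNReal w := by
    refine lipschitzWith_of_nnnorm_deriv_le (fun x => (hwd x).differentiableAt) fun x => ?_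
    rw [← NNReal.coe_le_coe, coe_nnnorm, (hwd x).deriv, Real.norm_eq_abs,
      Real.coe_toNNReal _ (by positivity)]
    calc |σ * q x - p * 1| ≤ |σ * q x| + |p * 1| := abs_sub _ _
      _ ≤ S + 1 + |p| := by rw [abs_mul, hσ1, one_mul, mul_one]; linarith [hqS x]
  have key : ∀ x, |(p + (σ * q x - p * 1)) ^ 2 / 2 - V x - c| ≤ δ := fun x => by
    have h1 := _root_.abs_le.1 (hqs x)
    have h2 := Real.sqrt_nonneg (2 * (V x + c))
    have h3 : √(2 * (V x + c)) ^ 2 = 2 * (V x + c) :=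
      Real.sq_sqrt (by have := hV0 x; positivity)
    have h4 : (p + (σ * q x - p * 1)) ^ 2 = q x ^ 2 := by linear_combination q x ^ 2 * hσ
    have h5 : q x ^ 2 / 2 - V x - c
        = (q x - √(2 * (V x + c))) * ((q x + √(2 * (V x + c))) / 2) := by
      linear_combination (1 / 2 : ℝ) * h3
    rw [h4, h5, abs_mul]
    refine le_trans (mul_le_mul (hqs x) (?_ : _ ≤ S + 1) (abs_nonneg _) hε0.le) hε2
    have := _root_.abs_le.1 (hqS x)
    rw [_root_.abs_le]
    constructor <;> linarith [hsS x]
  refine ⟨w, ⟨C, fun x => ?_⟩, hlip.uniformContinuous, ⟨_, hlip⟩, ?_, ?_⟩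
  · have : w x = σ * ((∫ t in (0 : ℝ)..x, q t) - |p| * x) := by
      simp only [hw]; linear_combination -x * hp
    rw [this, abs_mul, hσ1, one_mul]
    exact hC x
  · intro φ hφ x hx
    have h1 := hx.hasDerivAt_eq_zero
      ((hwd x).sub ((hφ.differentiable one_ne_zero x).hasDerivAt))
    have h2 : deriv φ x = σ * q x - p * 1 := by linarith
    have := (_root_.abs_le.1 (key x)).2
    rw [h2]; simp only; linarith
  · intro φ hφ x hx
    have h1 := hx.hasDerivAt_eq_zero
      ((hwd x).sub ((hφ.differentiable one_ne_zero x).hasDerivAt))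
    have h2 : deriv φ x = σ * q x - p * 1 := by linarith
    have := (_root_.abs_le.1 (key x)).1
    rw [h2]; simp only; linarith

end Viscosity

/-! ### The flat part and the characterisation of the effective constant -/

theorem HasApproxMean.exists_abs_integral_sub_le {f : ℝ → ℝ} {m : ℝ} (h : HasApproxMean f m)
    (hf : Continuous f) {ε : ℝ} (hε : 0 < ε) :
    ∃ B, ∀ x y, |(∫ t in x..y, f t) - m * (y - x)| ≤ ε * |y - x| + B := by
  obtain ⟨q, hq, hqf, B, hB⟩ := h ε hε
  refine ⟨2 * B, fun x y => ?_⟩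
  have hi : ∀ x y, IntervalIntegrable q volume x y := fun x y => hq.intervalIntegrable _ _
  have h1 : |∫ t in x..y, (f t - q t)| ≤ ε * |y - x| := by
    rw [← Real.norm_eq_abs]
    refine intervalIntegral.norm_integral_le_of_norm_le_const fun t _ => ?_
    rw [Real.norm_eq_abs, abs_sub_comm]
    exact hqf t
  rw [intervalIntegral.integral_sub (hf.intervalIntegrable _ _) (hi _ _)] at h1
  have h2 := intervalIntegral.integral_add_adjacent_intervals (hi 0 x) (hi x y)
  have h3 := abs_le.1 (hB x)
  have h4 := abs_le.1 (hB y)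
  have h5 := abs_le.1 h1
  rw [abs_le]
  constructor <;> linarith

/-- One-sided first-order condition at a right minimum. -/
theorem HasDerivAt.nonneg_of_eventually_nhdsGT {h : ℝ → ℝ} {d x : ℝ} (hd : HasDerivAt h d x)
    (hx : ∀ᶠ y in 𝓝[>] x, h x ≤ h y) : 0 ≤ d := by
  have h1 : Tendsto (slope h x) (𝓝[>] x) (𝓝 d) :=
    (hasDerivAt_iff_tendsto_slope.1 hd).mono_left (nhdsWithin_mono _ fun y hy => ne_of_gt hy)
  refine ge_of_tendsto h1 ?_
  filter_upwards [hx, self_mem_nhdsWithin] with y hy hxy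
  rw [slope_def_field]
  exact div_nonneg (sub_nonneg.2 hy) (sub_nonneg.2 (le_of_lt hxy))

/-- One-sided first-order condition at a left minimum. -/
theorem HasDerivAt.nonpos_of_eventually_nhdsLT {h : ℝ → ℝ} {d x : ℝ} (hd : HasDerivAt h d x)
    (hx : ∀ᶠ y in 𝓝[<] x, h x ≤ h y) : d ≤ 0 := by
  have h1 : Tendsto (slope h x) (𝓝[<] x) (𝓝 d) :=
    (hasDerivAt_iff_tendsto_slope.1 hd).mono_left (nhdsWithin_mono _ fun y hy => ne_of_lt hy)
  refine le_of_tendsto h1 ?_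
  filter_upwards [hx, self_mem_nhdsWithin] with y hy hxy
  rw [slope_def_field]
  exact div_nonpos_of_nonneg_of_nonpos (sub_nonneg.2 hy) (sub_nonpos.2 (le_of_lt hxy))

/-- The corrector is the distance to `{V ≤ δ}` for the degenerate length `∫ √(2V)`, tilted by `-p *
(x - y)`. The gap `|p| < m` makes the tilted distance coercive, hence minimisers exist and `w` is
bounded below; relative density of the target bounds `w` above. -/
theorem isEffectiveConstant_zero {V : ℝ → ℝ} {p m K : ℝ} (hV : Continuous V)
    (hV0 : ∀ x, 0 ≤ V x) (hVK : ∀ x, V x ≤ K) (hrec : Recurrent V)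
    (hm : HasApproxMean (fun x => √(2 * V x)) m) (hp : |p| < m) :
    IsEffectiveConstant (fun x q => q ^ 2 / 2 - V x) p 0 := by
  intro δ hδ
  set s : ℝ → ℝ := fun x => √(2 * V x) with hs
  have hsc : Continuous s := by fun_prop
  have hs0 : ∀ x, 0 ≤ s x := fun x => Real.sqrt_nonneg _
  have hs2 : ∀ x, s x ^ 2 = 2 * V x := fun x => Real.sq_sqrt (by have := hV0 x; positivity)
  set M := √(2 * K)
  have hsM : ∀ x, s x ≤ M := fun x => Real.sqrt_le_sqrt (by linarith [hVK x])
  have hM0 : 0 ≤ M := Real.sqrt_nonneg _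
  set S : ℝ → ℝ := fun x => ∫ t in (0 : ℝ)..x, s t with hS
  have hSd : ∀ x, HasDerivAt S (s x) x := hasDerivAt_primitive hsc
  have hSc : Continuous S := continuous_iff_continuousAt.2 fun x => (hSd x).continuousAt
  have hSmono : Monotone S := monotone_of_deriv_nonneg (fun x => (hSd x).differentiableAt)
    fun x => by rw [(hSd x).deriv]; exact hs0 x
  have hSsub : ∀ x y, S y - S x = ∫ t in x..y, s t := fun x y => by
    rw [sub_eq_iff_eq_add, add_comm]
    exact (intervalIntegral.integral_add_adjacent_intervals (hsc.intervalIntegrable _ _)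
      (hsc.intervalIntegrable _ _)).symm
  have hSlip : ∀ x y, |S x - S y| ≤ M * |x - y| := fun x y => by
    rw [hSsub, ← Real.norm_eq_abs]
    refine intervalIntegral.norm_integral_le_of_norm_le_const fun t _ => ?_
    rw [Real.norm_eq_abs, abs_of_nonneg (hs0 t)]
    exact hsM t
  set η := (m - |p|) / 2 with hη
  have hη0 : 0 < η := by linarith
  obtain ⟨B, hB⟩ := hm.exists_abs_integral_sub_le hsc hη0
  obtain ⟨L, hL⟩ := hrec δ hδ
  set Z : Set ℝ := {y | V y ≤ δ} with hZ
  have hZc : IsClosed Z := isClosed_le hV continuous_const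
  set g : ℝ → ℝ → ℝ := fun x y => |S x - S y| - p * (x - y) with hg
  have hgc : ∀ x, Continuous (g x) := fun x => by fun_prop
  have hglow : ∀ x y, η * |x - y| - B ≤ g x y := fun x y => by
    have h1 := hB y x
    rw [← hSsub] at h1
    have h2 : m * |x - y| ≤ |S x - S y| + η * |x - y| + B := by
      have h3 := abs_le.1 h1
      have h4 := abs_le.1 (le_refl |S x - S y|)
      rcases abs_cases (x - y) with ⟨h, -⟩ | ⟨h, -⟩ <;> rw [h] at h3 ⊢ <;> nlinarith
    have h3 : p * (x - y) ≤ |p| * |x - y| := by rw [← abs_mul]; exact le_abs_self _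
    have h4 : |p| = m - 2 * η := by rw [hη]; ring
    rw [h4] at h3
    simp only [hg]
    linarith
  have hmin : ∀ x, ∃ y ∈ Z, ∀ z ∈ Z, g x y ≤ g x z := fun x => by
    obtain ⟨y₀, -, -, hy₀⟩ := hL x
    obtain ⟨y, hy, hmin⟩ := ContinuousOn.exists_isMinOn' (s := Z) (f := g x) (hgc x).continuousOn
      hZc (x₀ := y₀) hy₀ (by
        refine Eventually.filter_mono inf_le_left ?_
        refine (tendsto_cocompact_atTop_of_abs_le (k := η) (C := η * |x| + B) hη0
          fun y => ?_).eventually_ge_atTop _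
        have h1 : |y| ≤ |x| + |x - y| := by
          have := abs_sub x (x - y); rwa [sub_sub_cancel] at this
        have := hglow x y
        nlinarith)
    exact ⟨y, hy, fun z hz => hmin hz⟩
  choose Y hYZ hYmin using hmin
  set w : ℝ → ℝ := fun x => g x (Y x) with hw
  -- The triangle inequality for the distance; it yields both the Lipschitz bound and the
  -- subsolution property.
  have hwsub : ∀ x x', w x - w x' ≤ |S x - S x'| - p * (x - x') := fun x x' => by
    have h1 := hYmin x (Y x') (hYZ x')
    have h2 := abs_sub_le (S x) (S x') (S (Y x'))
    simp only [hw, hg] at h1 ⊢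
    linarith
  have hlip : LipschitzWith (M + |p|).toNNReal w := by
    refine LipschitzWith.of_le_add_mul _ fun x y => ?_
    rw [Real.coe_toNNReal _ (by positivity), Real.dist_eq]
    have h1 := hwsub x y
    have h2 := hSlip x y
    have h3 : -(p * (x - y)) ≤ |p| * |x - y| := by rw [← abs_mul]; exact neg_le_abs _
    linarith
  have hwd : ∀ φ : ℝ → ℝ, ContDiff ℝ 1 φ → ∀ x, HasDerivAt φ (deriv φ x) x := fun φ hφ x =>
    (hφ.differentiable one_ne_zero x).hasDerivAt
  refine ⟨w, ⟨(M + |p|) * |L| + |B|, fun x => ?_⟩, hlip.uniformContinuous, ⟨_, hlip⟩, ?_, ?_⟩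
  · rw [abs_le]
    constructor
    · have h1 := hglow x (Y x)
      have h2 : 0 ≤ η * |x - Y x| := by positivity
      have h3 : 0 ≤ (M + |p|) * |L| := by positivity
      simp only [hw]
      linarith [le_abs_self B]
    · obtain ⟨y, hy1, hy2, hy⟩ := hL x
      have h1 : w x ≤ g x y := hYmin x y hy
      have h2 := hSlip x y
      have h3 : -(p * (x - y)) ≤ |p| * |x - y| := by rw [← abs_mul]; exact neg_le_abs _
      have h4 : |x - y| ≤ |L| := by
        rw [abs_sub_comm, abs_of_nonneg (by linarith : (0 : ℝ) ≤ y - x)]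
        linarith [le_abs_self L]
      have h5 : (M + |p|) * |x - y| ≤ (M + |p|) * |L| :=
        mul_le_mul_of_nonneg_left h4 (by positivity)
      simp only [hg] at h1
      linarith [abs_nonneg B]
  · intro φ hφ x hx
    -- The upper barrier has a kink at `x`, so its two sides are differentiated separately; they
    -- bound `p + φ'` below and above by `∓ s x`.
    have hmax : ∀ᶠ y in 𝓝 x, φ x - φ y ≤ |S x - S y| - p * (x - y) :=
      hx.mono fun y hy => by have := hwsub x y; linarith
    have h1 : 0 ≤ deriv φ x + s x + p := by
      have hd : HasDerivAt (fun y => φ y + S y + p * y) (deriv φ x + s x + p * 1) x :=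
        ((hwd φ hφ x).add (hSd x)).add ((hasDerivAt_id x).const_mul p)
      have := hd.nonneg_of_eventually_nhdsGT (by
        filter_upwards [hmax.filter_mono nhdsWithin_le_nhds, self_mem_nhdsWithin] with y hy hxy
        rw [abs_of_nonpos (sub_nonpos.2 (hSmono (le_of_lt hxy)))] at hy
        linarith)
      linarith
    have h2 : deriv φ x - s x + p ≤ 0 := by
      have hd : HasDerivAt (fun y => φ y - S y + p * y) (deriv φ x - s x + p * 1) x :=
        ((hwd φ hφ x).sub (hSd x)).add ((hasDerivAt_id x).const_mul p)
      have := hd.nonpos_of_eventually_nhdsLT (by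
        filter_upwards [hmax.filter_mono nhdsWithin_le_nhds, self_mem_nhdsWithin] with y hy hxy
        rw [abs_of_nonneg (sub_nonneg.2 (hSmono (le_of_lt hxy)))] at hy
        linarith)
      linarith
    have h3 : (p + deriv φ x) ^ 2 ≤ s x ^ 2 := sq_le_sq' (by linarith) (by linarith)
    rw [hs2] at h3
    simp only
    linarith
  · intro φ hφ x hx
    simp only [zero_sub]
    -- On the target set the Hamiltonian is at least `-V ≥ -δ` whatever the slope. Off it the
    -- nearest target point is not `x`, and that branch of the distance is differentiable at `x`.
    by_cases hxZ : V x ≤ δ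
    · have := sq_nonneg (p + deriv φ x)
      linarith
    suffices h : (p + deriv φ x) ^ 2 = s x ^ 2 by rw [h, hs2]; linarith
    have hne : Y x ≠ x := fun h => hxZ (by have := hYZ x; rwa [h] at this)
    have hmin : ∀ᶠ z in 𝓝 x, g x (Y x) - φ x ≤ g z (Y x) - φ z :=
      hx.mono fun z hz => by
        have h1 := hYmin z (Y x) (hYZ x)
        simp only [hw] at hz
        linarith
    rcases lt_or_gt_of_ne hne with hlt | hgt
    · have hloc : IsLocalMin (fun z => S z - p * z - φ z) x := by
        filter_upwards [hmin, lt_mem_nhds hlt] with z hz hYz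
        simp only [hg] at hz
        rw [abs_of_nonneg (sub_nonneg.2 (hSmono hlt.le)),
          abs_of_nonneg (sub_nonneg.2 (hSmono hYz.le))] at hz
        linarith
      have := hloc.hasDerivAt_eq_zero
        (((hSd x).sub ((hasDerivAt_id x).const_mul p)).sub (hwd φ hφ x))
      rw [show p + deriv φ x = s x by linarith]
    · have hloc : IsLocalMin (fun z => -S z - p * z - φ z) x := by
        filter_upwards [hmin, gt_mem_nhds hgt] with z hz hYz
        simp only [hg] at hz
        rw [abs_of_nonpos (sub_nonpos.2 (hSmono hgt.le)),
          abs_of_nonpos (sub_nonpos.2 (hSmono hYz.le))] at hz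
        linarith
      have := hloc.hasDerivAt_eq_zero
        (((hSd x).neg.sub ((hasDerivAt_id x).const_mul p)).sub (hwd φ hφ x))
      rw [show p + deriv φ x = -s x by linarith, neg_sq]

/-- The effective constant of `q ^ 2 / 2 - V` is `0` on the flat part `|p| ≤ G 0`, and the inverse
of the mean `G` of `√(2 * (V + c))` beyond it. -/
theorem isEffectiveConstant_iff {V G : ℝ → ℝ} {K : ℝ} (hV : Continuous V)
    (hV0 : ∀ x, 0 ≤ V x) (hVK : ∀ x, V x ≤ K) (hrec : Recurrent V)
    (hG : ∀ c, 0 ≤ c → HasApproxMean (fun x => √(2 * (V x + c))) (G c))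
    (hGc : ContinuousOn G (Set.Ici 0)) (p c : ℝ) :
    IsEffectiveConstant (fun x q => q ^ 2 / 2 - V x) p c ↔
      0 ≤ c ∧ |p| ≤ G c ∧ (0 < c → G c = |p|) := by
  constructor
  · intro h
    have hc : 0 ≤ c := by
      refine le_of_forall_pos_le_add fun δ hδ => ?_
      obtain ⟨w, ⟨B, hB⟩, hw, -, hsub, -⟩ := h δ hδ
      exact hsub.nonneg hw.continuous hB hV hrec
    have hright : Tendsto (fun δ => G (c + δ)) (𝓝[>] 0) (𝓝 (G c)) := by
      refine (hGc c hc).tendsto.comp (tendsto_nhdsWithin_iff.2 ⟨?_, ?_⟩)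
      · have : Tendsto (fun δ : ℝ => c + δ) (𝓝 0) (𝓝 (c + 0)) := by
          exact (continuous_const.add continuous_id).tendsto 0
        rw [add_zero] at this
        exact this.mono_left nhdsWithin_le_nhds
      · filter_upwards [self_mem_nhdsWithin] with δ hδ
        exact add_nonneg hc (le_of_lt hδ)
    have hle : |p| ≤ G c := by
      refine ge_of_tendsto hright ?_
      filter_upwards [self_mem_nhdsWithin] with δ hδ
      have hδ : 0 < δ := hδ
      obtain ⟨w, ⟨B, hB⟩, hw, -, hsub, -⟩ := h δ hδ
      exact hsub.abs_le hw.continuous hB (by linarith) hV0 (hG _ (by linarith))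
    refine ⟨hc, hle, fun hc0 => le_antisymm ?_ hle⟩
    -- The supersolution comparison requires the level `c - δ` to be positive, so it gives equality
    -- only for `c > 0`; this is what leaves room for the flat part.
    have hleft : Tendsto (fun δ => G (c - δ)) (𝓝[>] 0) (𝓝 (G c)) := by
      have h1 : Tendsto G (𝓝 c) (𝓝 (G c)) := hGc.continuousAt (Ici_mem_nhds hc0)
      have : Tendsto (fun δ : ℝ => c - δ) (𝓝 0) (𝓝 (c - 0)) :=
        (continuous_const.sub continuous_id).tendsto 0
      rw [sub_zero] at this
      exact h1.comp (this.mono_left nhdsWithin_le_nhds)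
    refine le_of_tendsto hleft ?_
    filter_upwards [Ioo_mem_nhdsGT hc0] with δ hδ
    obtain ⟨w, ⟨B, hB⟩, hw, -, -, hsup⟩ := h δ hδ.1
    exact hsup.le_abs hw.continuous hB (by linarith [hδ.2]) hV0 (hG _ (by linarith [hδ.2]))
  · rintro ⟨hc, hle, heq⟩
    rcases hle.lt_or_eq with hlt | hpe
    · have hc0 : c = 0 := by
        by_contra hne
        exact hlt.ne (heq (lt_of_le_of_ne hc (Ne.symm hne))).symm
      subst hc0
      exact isEffectiveConstant_zero hV hV0 hVK hrec (by simpa using hG 0 le_rfl) hlt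
    · exact isEffectiveConstant_of_hasApproxMean hc hV0 hVK (by rw [hpe]; exact hG c hc)

/-! ### Trigonometric polynomials and unique ergodicity of the line flow -/

/-- The character `(x, y) ↦ exp (2πi (k x + l y))` of the torus. -/
noncomputable def torusChar (k : ℤ × ℤ) : ℝ × ℝ → ℂ := fun z =>
  Complex.exp (2 * Real.pi * Complex.I * k.1 * z.1) *
    Complex.exp (2 * Real.pi * Complex.I * k.2 * z.2)

/-- Trigonometric polynomials on the torus. -/
noncomputable def trigPoly : Submodule ℂ (ℝ × ℝ → ℂ) := Submodule.span ℂ (Set.range torusChar)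

theorem torusChar_mul (k l : ℤ × ℤ) : torusChar k * torusChar l = torusChar (k + l) := by
  funext z
  simp only [torusChar, Pi.mul_apply, ← Complex.exp_add, Prod.fst_add, Prod.snd_add, Int.cast_add]
  congr 1
  ring

theorem trigPoly_mul_mem {F G : ℝ × ℝ → ℂ} (hF : F ∈ trigPoly) (hG : G ∈ trigPoly) :
    F * G ∈ trigPoly := by
  have h := Submodule.mul_mem_mul hF hG
  rw [trigPoly, Submodule.span_mul_span] at h
  refine Submodule.span_mono ?_ h
  rintro _ ⟨_, ⟨k, rfl⟩, _, ⟨l, rfl⟩, rfl⟩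
  exact ⟨k + l, (torusChar_mul k l).symm⟩

theorem torusChar_mem (k : ℤ × ℤ) : torusChar k ∈ trigPoly := Submodule.subset_span ⟨k, rfl⟩

theorem one_mem_trigPoly : (1 : ℝ × ℝ → ℂ) ∈ trigPoly := by
  convert torusChar_mem 0
  funext z
  simp [torusChar]

theorem trigPoly_pow_mem {F : ℝ × ℝ → ℂ} (hF : F ∈ trigPoly) (n : ℕ) : F ^ n ∈ trigPoly := by
  induction n with
  | zero => simpa using one_mem_trigPoly
  | succ n ih => rw [pow_succ]; exact trigPoly_mul_mem ih hF

theorem integral_exp_int_eq_zero {k : ℤ} (hk : k ≠ 0) :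
    (∫ x in (0 : ℝ)..1, Complex.exp (2 * Real.pi * Complex.I * k * x)) = 0 := by
  have hc : (2 * Real.pi * Complex.I * k : ℂ) ≠ 0 := by
    simp [Real.pi_ne_zero, hk]
  rw [integral_exp_mul_complex hc]
  have : Complex.exp (2 * Real.pi * Complex.I * k * (1 : ℝ)) = 1 := by
    rw [Complex.exp_eq_one_iff]
    exact ⟨k, by push_cast; ring⟩
  rw [this]
  simp

/-- Along the line a nonconstant character is `exp (2πiκt)` with `κ ≠ 0` by non-resonance, so its
integral is bounded by `2 / |2πκ|`, while its torus mean is `0`. The rest is linearity; continuity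
is carried along to split the integrals. -/
theorem trigPoly_continuous_and_mean {ξ₁ ξ₂ : ℝ} (hξ : NonResonant ξ₁ ξ₂) {F : ℝ × ℝ → ℂ}
    (hF : F ∈ trigPoly) : Continuous F ∧ ∃ B : ℝ, ∀ x : ℝ,
      ‖(∫ t in (0 : ℝ)..x, F (ξ₁ * t, ξ₂ * t)) -
        (∫ x in (0 : ℝ)..1, ∫ y in (0 : ℝ)..1, F (x, y)) * x‖ ≤ B := by
  induction hF using Submodule.span_induction with
  | mem F hF =>
    obtain ⟨⟨k, l⟩, rfl⟩ := hF
    refine ⟨by unfold torusChar; fun_prop, ?_⟩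
    by_cases hkl : (k, l) = (0, 0)
    · rw [Prod.mk.injEq] at hkl
      obtain ⟨rfl, rfl⟩ := hkl
      exact ⟨0, fun x => by simp [torusChar]⟩
    have h0 : (∫ x in (0 : ℝ)..1, ∫ y in (0 : ℝ)..1, torusChar (k, l) (x, y)) = 0 := by
      simp only [torusChar, intervalIntegral.integral_const_mul, intervalIntegral.integral_mul_const]
      rw [Prod.mk.injEq, not_and_or] at hkl
      rcases hkl with h | h
      · rw [integral_exp_int_eq_zero h, zero_mul]
      · rw [integral_exp_int_eq_zero h, mul_zero]
    set κ : ℝ := k * ξ₁ + l * ξ₂ with hκ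
    have hκ0 : κ ≠ 0 := hξ k l hkl
    have hc : (2 * Real.pi * Complex.I * κ : ℂ) ≠ 0 := by
      simp [Real.pi_ne_zero, hκ0]
    refine ⟨2 / ‖(2 * Real.pi * Complex.I * κ : ℂ)‖, fun x => ?_⟩
    have h1 : ∀ t : ℝ, torusChar (k, l) (ξ₁ * t, ξ₂ * t) =
        Complex.exp ((2 * Real.pi * Complex.I * κ : ℂ) * t) := fun t => by
      simp only [torusChar, ← Complex.exp_add, hκ]
      congr 1
      push_cast
      ring
    simp only [h1]
    rw [h0, zero_mul, sub_zero, integral_exp_mul_complex hc, norm_div]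
    gcongr
    have hn : ∀ t : ℝ, ‖Complex.exp ((2 * Real.pi * Complex.I * κ : ℂ) * t)‖ = 1 := fun t => by
      rw [show (2 * Real.pi * Complex.I * κ : ℂ) * t = ((2 * Real.pi * κ * t : ℝ) : ℂ) * Complex.I
        by push_cast; ring]
      exact Complex.norm_exp_ofReal_mul_I _
    calc _ ≤ _ := norm_sub_le _ _
      _ = 2 := by rw [hn, hn]; norm_num
  | zero => exact ⟨continuous_const, 0, fun x => by simp⟩
  | add F G _ _ hF hG =>
    obtain ⟨hFc, B, hB⟩ := hF
    obtain ⟨hGc, C, hC⟩ := hG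
    refine ⟨hFc.add hGc, B + C, fun x => ?_⟩
    have e1 : (∫ t in (0 : ℝ)..x, (F + G) (ξ₁ * t, ξ₂ * t)) =
        (∫ t in (0 : ℝ)..x, F (ξ₁ * t, ξ₂ * t)) + ∫ t in (0 : ℝ)..x, G (ξ₁ * t, ξ₂ * t) :=
      intervalIntegral.integral_add ((by fun_prop : Continuous _).intervalIntegrable _ _)
        ((by fun_prop : Continuous _).intervalIntegrable _ _)
    have e2 : ∀ x : ℝ, (∫ y in (0 : ℝ)..1, (F + G) (x, y)) =
        (∫ y in (0 : ℝ)..1, F (x, y)) + ∫ y in (0 : ℝ)..1, G (x, y) := fun x =>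
      intervalIntegral.integral_add ((by fun_prop : Continuous _).intervalIntegrable _ _)
        ((by fun_prop : Continuous _).intervalIntegrable _ _)
    have hi : ∀ F : ℝ × ℝ → ℂ, Continuous F →
        IntervalIntegrable (fun x => ∫ y in (0 : ℝ)..1, F (x, y)) volume 0 1 := fun F hF =>
      (intervalIntegral.continuous_parametric_intervalIntegral_of_continuous'
        (f := fun x y => F (x, y)) hF 0 1).intervalIntegrable _ _
    rw [e1]
    simp only [e2]
    rw [intervalIntegral.integral_add (hi F hFc) (hi G hGc)]
    refine le_trans (le_of_eq ?_) ((norm_add_le _ _).trans (add_le_add (hB x) (hC x)))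
    congr 1
    ring
  | smul a F _ hF =>
    obtain ⟨hFc, B, hB⟩ := hF
    refine ⟨hFc.const_smul a, ‖a‖ * B, fun x => ?_⟩
    simp only [Pi.smul_apply, smul_eq_mul, intervalIntegral.integral_const_mul]
    rw [mul_assoc, ← mul_sub, norm_mul]
    exact mul_le_mul_of_nonneg_left (hB x) (norm_nonneg a)

theorem cos_mem_trigPoly :
    (fun z : ℝ × ℝ => ((Real.cos (2 * Real.pi * z.1) : ℝ) : ℂ)) ∈ trigPoly ∧
    (fun z : ℝ × ℝ => ((Real.cos (2 * Real.pi * z.2) : ℝ) : ℂ)) ∈ trigPoly := by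
  constructor
  · convert trigPoly.smul_mem (1 / 2 : ℂ)
      (trigPoly.add_mem (torusChar_mem (1, 0)) (torusChar_mem (-1, 0))) using 1
    funext z
    simp [torusChar, Complex.cos]
    ring_nf
  · convert trigPoly.smul_mem (1 / 2 : ℂ)
      (trigPoly.add_mem (torusChar_mem (0, 1)) (torusChar_mem (0, -1))) using 1
    funext z
    simp [torusChar, Complex.cos]
    ring_nf

theorem sin_mem_trigPoly :
    (fun z : ℝ × ℝ => ((Real.sin (2 * Real.pi * z.1) : ℝ) : ℂ)) ∈ trigPoly ∧
    (fun z : ℝ × ℝ => ((Real.sin (2 * Real.pi * z.2) : ℝ) : ℂ)) ∈ trigPoly := by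
  constructor
  · convert trigPoly.smul_mem (Complex.I / 2 : ℂ)
      (trigPoly.sub_mem (torusChar_mem (-1, 0)) (torusChar_mem (1, 0))) using 1
    funext z
    simp [torusChar, Complex.sin]
    ring_nf
  · convert trigPoly.smul_mem (Complex.I / 2 : ℂ)
      (trigPoly.sub_mem (torusChar_mem (0, -1)) (torusChar_mem (0, 1))) using 1
    funext z
    simp [torusChar, Complex.sin]
    ring_nf

theorem eval_mem_trigPoly {v : ℝ × ℝ → ℝ} (hv : (fun z => (v z : ℂ)) ∈ trigPoly)
    (P : Polynomial ℝ) : (fun z => ((P.eval (v z) : ℝ) : ℂ)) ∈ trigPoly := by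
  have : (fun z => ((P.eval (v z) : ℝ) : ℂ)) =
      ∑ n ∈ P.support, (P.coeff n : ℂ) • (fun z => (v z : ℂ)) ^ n := by
    funext z
    simp [Polynomial.eval_eq_sum, Polynomial.sum]
  rw [this]
  exact Submodule.sum_mem _ fun n _ => Submodule.smul_mem _ _ (trigPoly_pow_mem hv n)

/-- Unique ergodicity of the irrational line flow, for functions of a trigonometric polynomial. -/
theorem hasApproxMean_comp {ξ₁ ξ₂ : ℝ} (hξ : NonResonant ξ₁ ξ₂) {v : ℝ × ℝ → ℝ}
    (hv : (fun z => (v z : ℂ)) ∈ trigPoly) {a b : ℝ} (hvI : ∀ z, v z ∈ Set.Icc a b) {Φ : ℝ → ℝ}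
    (hΦ : Continuous Φ) :
    HasApproxMean (fun t => Φ (v (ξ₁ * t, ξ₂ * t)))
      (∫ x in (0 : ℝ)..1, ∫ y in (0 : ℝ)..1, Φ (v (x, y))) := by
  intro ε hε
  have hvc : Continuous v :=
    Complex.continuous_re.comp (trigPoly_continuous_and_mean hξ hv).1
  have hΦc : Continuous fun z => Φ (v z) := hΦ.comp hvc
  obtain ⟨P, hP⟩ := exists_polynomial_near_of_continuousOn a b Φ hΦ.continuousOn (ε / 2)
    (by positivity)
  have hPc : Continuous fun z => P.eval (v z) := P.continuous.comp hvc
  obtain ⟨-, B, hB⟩ := trigPoly_continuous_and_mean hξ (eval_mem_trigPoly hv P)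
  set m := ∫ x in (0 : ℝ)..1, ∫ y in (0 : ℝ)..1, Φ (v (x, y)) with hm
  set n := ∫ x in (0 : ℝ)..1, ∫ y in (0 : ℝ)..1, P.eval (v (x, y)) with hn
  have hmn : |m - n| ≤ ε / 2 := by
    have hc : ∀ g : ℝ × ℝ → ℝ, Continuous g →
        Continuous fun x => ∫ y in (0 : ℝ)..1, g (x, y) := fun g hg =>
      intervalIntegral.continuous_parametric_intervalIntegral_of_continuous'
        (f := fun x y => g (x, y)) hg 0 1
    rw [hm, hn, ← intervalIntegral.integral_sub ((hc _ hΦc).intervalIntegrable _ _)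
      ((hc _ hPc).intervalIntegrable _ _)]
    have : ∀ x ∈ Set.uIoc (0 : ℝ) 1, ‖(∫ y in (0 : ℝ)..1, Φ (v (x, y))) -
        ∫ y in (0 : ℝ)..1, P.eval (v (x, y))‖ ≤ ε / 2 := fun x _ => by
      rw [← intervalIntegral.integral_sub ((by fun_prop : Continuous _).intervalIntegrable _ _)
        ((by fun_prop : Continuous _).intervalIntegrable _ _)]
      have : ∀ y ∈ Set.uIoc (0 : ℝ) 1, ‖Φ (v (x, y)) - P.eval (v (x, y))‖ ≤ ε / 2 := fun y _ => by
        rw [Real.norm_eq_abs, abs_sub_comm]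
        exact (hP _ (hvI _)).le
      simpa using intervalIntegral.norm_integral_le_of_norm_le_const this
    simpa using intervalIntegral.norm_integral_le_of_norm_le_const this
  have hqc : Continuous fun t : ℝ => P.eval (v (ξ₁ * t, ξ₂ * t)) := by fun_prop
  -- Adding `m - n` corrects the mean to exactly `m`, at a uniform cost of at most `ε / 2`.
  refine ⟨fun t => P.eval (v (ξ₁ * t, ξ₂ * t)) + (m - n), by fun_prop, fun x => ?_, B,
    fun x => ?_⟩
  · have h1 := abs_lt.1 (hP _ (hvI (ξ₁ * x, ξ₂ * x)))
    have h2 := abs_le.1 hmn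
    rw [abs_le]
    constructor <;> linarith
  · have h := hB x
    simp only [intervalIntegral.integral_ofReal] at h
    rw [← Complex.ofReal_mul, ← Complex.ofReal_sub, Complex.norm_real, Real.norm_eq_abs] at h
    rw [intervalIntegral.integral_add (hqc.intervalIntegrable _ _)
      (continuous_const.intervalIntegrable _ _), intervalIntegral.integral_const]
    convert h using 2
    simp only [smul_eq_mul, hn]
    ring

/-! ### The law of the potential on the torus -/

theorem integral_comp_cos (Ψ : ℝ → ℝ) : (∫ x in (0 : ℝ)..1, Ψ (Real.cos (2 * Real.pi * x))) =
    ∫ x in (-1 / 2 : ℝ)..(1 / 2), Ψ (Real.cos (2 * Real.pi * x)) := by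
  have hp : Function.Periodic (fun x => Ψ (Real.cos (2 * Real.pi * x))) 1 := fun x => by
    simp only [mul_add, mul_one, Real.cos_add_two_pi]
  convert hp.intervalIntegral_add_eq 0 (-1 / 2) using 2 <;> norm_num

/-- A quarter-period shift turns sine into cosine, which is why both prototypes share one law. -/
theorem integral_comp_sin (Ψ : ℝ → ℝ) : (∫ x in (0 : ℝ)..1, Ψ (Real.sin (2 * Real.pi * x))) =
    ∫ x in (-1 / 2 : ℝ)..(1 / 2), Ψ (Real.cos (2 * Real.pi * x)) := by
  have hp : Function.Periodic (fun x => Ψ (Real.cos (2 * Real.pi * x))) 1 := fun x => by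
    simp only [mul_add, mul_one, Real.cos_add_two_pi]
  have h1 : ∀ x : ℝ, Real.sin (2 * Real.pi * x) = Real.cos (2 * Real.pi * (x - 1 / 4)) :=
    fun x => by rw [← Real.cos_sub_pi_div_two]; congr 1; ring
  simp only [h1]
  rw [intervalIntegral.integral_comp_sub_right (fun x => Ψ (Real.cos (2 * Real.pi * x))) (1 / 4)]
  convert hp.intervalIntegral_add_eq (0 - 1 / 4) (-1 / 2) using 2 <;> norm_num

/-- The unit square centred at the origin. -/
def unitSquare : Set (ℝ × ℝ) := Set.Ioc (-1 / 2) (1 / 2) ×ˢ Set.Ioc (-1 / 2) (1 / 2)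

/-- The function `2 - cos (2π x) - cos (2π y)` on the plane. -/
noncomputable def cosSum (z : ℝ × ℝ) : ℝ :=
  2 - Real.cos (2 * Real.pi * z.1) - Real.cos (2 * Real.pi * z.2)

/-- The law of `cosSum` under the uniform measure on the torus. -/
noncomputable def torusLaw : Measure ℝ := (volume.restrict unitSquare).map cosSum

theorem continuous_cosSum : Continuous cosSum := by unfold cosSum; fun_prop

instance : IsProbabilityMeasure torusLaw := by
  have : IsProbabilityMeasure ((volume : Measure (ℝ × ℝ)).restrict unitSquare) := by
    constructor
    rw [Measure.restrict_apply_univ, unitSquare, Measure.volume_eq_prod, Measure.prod_prod]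
    norm_num
  exact Measure.isProbabilityMeasure_map continuous_cosSum.aemeasurable

theorem cosSum_mem_Icc (z : ℝ × ℝ) : cosSum z ∈ Set.Icc (0 : ℝ) 4 := by
  have h1 := Real.cos_le_one (2 * Real.pi * z.1)
  have h2 := Real.cos_le_one (2 * Real.pi * z.2)
  have h3 := Real.neg_one_le_cos (2 * Real.pi * z.1)
  have h4 := Real.neg_one_le_cos (2 * Real.pi * z.2)
  constructor <;> unfold cosSum <;> linarith

theorem torusLaw_apply {s : Set ℝ} (hs : MeasurableSet s) :
    torusLaw s = volume (cosSum ⁻¹' s ∩ unitSquare) := by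
  rw [torusLaw, Measure.map_apply continuous_cosSum.measurable hs,
    Measure.restrict_apply (continuous_cosSum.measurable hs)]

theorem ae_torusLaw_mem_Icc : ∀ᵐ t ∂torusLaw, t ∈ Set.Icc (0 : ℝ) 4 := by
  refine (ae_map_iff continuous_cosSum.aemeasurable measurableSet_Icc).2 ?_
  exact Eventually.of_forall cosSum_mem_Icc

theorem integral_torusLaw {Φ : ℝ → ℝ} (hΦ : Continuous Φ) :
    ∫ t, Φ t ∂torusLaw = ∫ x in (-1 / 2 : ℝ)..(1 / 2), ∫ y in (-1 / 2 : ℝ)..(1 / 2),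
      Φ (2 - Real.cos (2 * Real.pi * x) - Real.cos (2 * Real.pi * y)) := by
  rw [torusLaw, integral_map continuous_cosSum.aemeasurable hΦ.aestronglyMeasurable, unitSquare,
    Measure.volume_eq_prod, setIntegral_prod]
  · rw [intervalIntegral.integral_of_le (by norm_num)]
    congr 1
    funext x
    rw [intervalIntegral.integral_of_le (by norm_num)]
    rfl
  · have hc : Continuous fun z => Φ (cosSum z) := hΦ.comp continuous_cosSum
    exact (hc.continuousOn.integrableOn_compact (isCompact_Icc.prod isCompact_Icc)).mono_set
      (Set.prod_mono Set.Ioc_subset_Icc_self Set.Ioc_subset_Icc_self)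

/-- The only place where the two prototypes are told apart; afterwards only the base function `v`
and its law matter. -/
theorem exists_prototype_data {γ : ℝ} {U : ℝ → ℝ → ℝ} (hU : U = sinPrototype γ ∨ U = cosPrototype γ)
    {ξ₁ ξ₂ : ℝ} (hξ : NonResonant ξ₁ ξ₂) :
    ∃ v : ℝ × ℝ → ℝ, Continuous v ∧ (∀ z, v z ∈ Set.Icc (0 : ℝ) 4) ∧
      (∀ x y, U x y = v (x, y) ^ γ) ∧
      ∀ Φ : ℝ → ℝ, Continuous Φ →
        (∫ x in (0 : ℝ)..1, ∫ y in (0 : ℝ)..1, Φ (v (x, y))) = ∫ t, Φ t ∂torusLaw ∧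
        HasApproxMean (fun t => Φ (v (ξ₁ * t, ξ₂ * t))) (∫ t, Φ t ∂torusLaw) := by
  have htwo : (fun _ : ℝ × ℝ => (2 : ℂ)) ∈ trigPoly := by
    convert trigPoly.smul_mem (2 : ℂ) one_mem_trigPoly using 1
    funext z
    simp
  rcases hU with rfl | rfl
  · set v : ℝ × ℝ → ℝ := fun z => 2 - Real.sin (2 * Real.pi * z.1) - Real.sin (2 * Real.pi * z.2)
      with hv
    have hvI : ∀ z, v z ∈ Set.Icc (0 : ℝ) 4 := fun z => by
      have h1 := Real.sin_le_one (2 * Real.pi * z.1)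
      have h2 := Real.sin_le_one (2 * Real.pi * z.2)
      have h3 := Real.neg_one_le_sin (2 * Real.pi * z.1)
      have h4 := Real.neg_one_le_sin (2 * Real.pi * z.2)
      constructor <;> simp only [hv] <;> linarith
    have hvt : (fun z => (v z : ℂ)) ∈ trigPoly := by
      convert trigPoly.sub_mem (trigPoly.sub_mem htwo sin_mem_trigPoly.1) sin_mem_trigPoly.2 using 1
      funext z
      simp [hv]
    refine ⟨v, by fun_prop, hvI, fun x y => rfl, fun Φ hΦ => ?_⟩
    have h : (∫ x in (0 : ℝ)..1, ∫ y in (0 : ℝ)..1, Φ (v (x, y))) = ∫ t, Φ t ∂torusLaw := by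
      rw [integral_torusLaw hΦ]
      simp only [hv]
      rw [← integral_comp_sin fun s => ∫ y in (-1 / 2 : ℝ)..(1 / 2),
        Φ (2 - s - Real.cos (2 * Real.pi * y))]
      congr 1
      funext x
      exact integral_comp_sin fun s => Φ (2 - Real.sin (2 * Real.pi * x) - s)
    exact ⟨h, h ▸ hasApproxMean_comp hξ hvt hvI hΦ⟩
  · set v : ℝ × ℝ → ℝ := cosSum with hv
    have hvt : (fun z => (v z : ℂ)) ∈ trigPoly := by
      convert trigPoly.sub_mem (trigPoly.sub_mem htwo cos_mem_trigPoly.1) cos_mem_trigPoly.2 using 1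
      funext z
      simp [hv, cosSum]
    refine ⟨v, continuous_cosSum, cosSum_mem_Icc, fun x y => rfl, fun Φ hΦ => ?_⟩
    have h : (∫ x in (0 : ℝ)..1, ∫ y in (0 : ℝ)..1, Φ (v (x, y))) = ∫ t, Φ t ∂torusLaw := by
      rw [integral_torusLaw hΦ]
      simp only [hv, cosSum]
      rw [← integral_comp_cos fun s => ∫ y in (-1 / 2 : ℝ)..(1 / 2),
        Φ (2 - s - Real.cos (2 * Real.pi * y))]
      congr 1
      funext x
      exact integral_comp_cos fun s => Φ (2 - Real.cos (2 * Real.pi * x) - s)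
    exact ⟨h, h ▸ hasApproxMean_comp hξ hvt cosSum_mem_Icc hΦ⟩

theorem one_sub_cos_two_pi_mul (x : ℝ) :
    1 - Real.cos (2 * Real.pi * x) = 2 * Real.sin (Real.pi * x) ^ 2 := by
  rw [show 2 * Real.pi * x = 2 * (Real.pi * x) by ring, Real.cos_two_mul, Real.cos_sq']
  ring

theorem one_sub_cos_le (x : ℝ) : 1 - Real.cos (2 * Real.pi * x) ≤ 2 * Real.pi ^ 2 * x ^ 2 := by
  have := Real.one_sub_sq_div_two_le_cos (x := 2 * Real.pi * x)
  nlinarith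

/-- Jordan's inequality `|sin y| ≥ (2/π) |y|` at `y = πx`, combined with `1 - cos (2y) = 2 sin² y`.
-/
theorem le_one_sub_cos {x : ℝ} (hx : |x| ≤ 1 / 2) : 8 * x ^ 2 ≤ 1 - Real.cos (2 * Real.pi * x) := by
  have h1 : 2 / Real.pi * |Real.pi * x| ≤ |Real.sin (Real.pi * x)| := by
    refine Real.mul_abs_le_abs_sin ?_
    rw [abs_mul, abs_of_pos Real.pi_pos]
    nlinarith [Real.pi_pos]
  rw [abs_mul, abs_of_pos Real.pi_pos] at h1
  have h2 : 2 / Real.pi * (Real.pi * |x|) = 2 * |x| := by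
    field_simp [Real.pi_ne_zero]
  rw [h2] at h1
  have h3 := pow_le_pow_left₀ (by positivity) h1 2
  rw [sq_abs, mul_pow, sq_abs] at h3
  rw [one_sub_cos_two_pi_mul]
  linarith

/-- The sublevel set lies in a square of half-side `√(t/8)`, of area `t / 2`. -/
theorem torusLaw_Iic_le {t : ℝ} (ht : 0 ≤ t) : torusLaw (Set.Iic t) ≤ ENNReal.ofReal (t / 2) := by
  rw [torusLaw_apply measurableSet_Iic]
  set r := √(t / 8) with hr
  have hr0 : 0 ≤ r := Real.sqrt_nonneg _
  have hr2 : r ^ 2 = t / 8 := Real.sq_sqrt (by positivity)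
  have hsub : cosSum ⁻¹' Set.Iic t ∩ unitSquare ⊆ Set.Icc (-r) r ×ˢ Set.Icc (-r) r := by
    rintro ⟨x, y⟩ ⟨h, hx, hy⟩
    simp only [Set.mem_preimage, Set.mem_Iic, cosSum, Set.mem_Ioc] at h hx hy
    have h1 := le_one_sub_cos (x := x) (abs_le.2 ⟨by linarith, hx.2⟩)
    have h2 := le_one_sub_cos (x := y) (abs_le.2 ⟨by linarith, hy.2⟩)
    refine ⟨?_, ?_⟩ <;> rw [Set.mem_Icc, ← abs_le] <;> refine abs_le_of_sq_le_sq ?_ hr0 <;>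
      rw [hr2] <;> nlinarith [sq_nonneg x, sq_nonneg y]
  refine (measure_mono hsub).trans (le_of_eq ?_)
  rw [Measure.volume_eq_prod, Measure.prod_prod, Real.volume_Icc, ← ENNReal.ofReal_mul (by linarith)]
  congr 1
  linear_combination 4 * hr2

/-- The sublevel set contains an open square of half-side `√t / (2π)`; the restriction `t ≤ 4` keeps
this square inside the unit square. -/
theorem le_torusLaw_Iio {t : ℝ} (ht : 0 ≤ t) (ht4 : t ≤ 4) :
    ENNReal.ofReal (t / Real.pi ^ 2) ≤ torusLaw (Set.Iio t) := by
  rw [torusLaw_apply measurableSet_Iio]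
  have hpi := Real.pi_gt_three
  set r := √t / (2 * Real.pi) with hr
  have hr0 : 0 ≤ r := by positivity
  have hr2 : 4 * Real.pi ^ 2 * r ^ 2 = t := by
    rw [hr, div_pow, Real.sq_sqrt ht]
    field_simp
    ring
  have hr1 : r < 1 / 2 := by
    have : √t ≤ 2 := Real.sqrt_le_iff.2 ⟨by norm_num, by linarith⟩
    rw [hr, div_lt_iff₀ (by positivity)]
    linarith
  have hsub : Set.Ioo (-r) r ×ˢ Set.Ioo (-r) r ⊆ cosSum ⁻¹' Set.Iio t ∩ unitSquare := by
    rintro ⟨x, y⟩ ⟨hx, hy⟩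
    simp only at hx hy
    refine ⟨?_, ⟨by linarith [hx.1], by linarith [hx.2]⟩, by linarith [hy.1], by linarith [hy.2]⟩
    have h1 := one_sub_cos_le x
    have h2 := one_sub_cos_le y
    have h3 : x ^ 2 < r ^ 2 := sq_lt_sq' hx.1 hx.2
    have h4 : y ^ 2 < r ^ 2 := sq_lt_sq' hy.1 hy.2
    have hpi2 : 0 < 2 * Real.pi ^ 2 := by positivity
    simp only [Set.mem_preimage, Set.mem_Iio, cosSum]
    nlinarith
  refine le_trans (le_of_eq ?_) (measure_mono hsub)
  rw [Measure.volume_eq_prod, Measure.prod_prod, Real.volume_Ioo, ← ENNReal.ofReal_mul (by linarith)]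
  congr 1
  rw [← hr2]
  field_simp
  ring

/-- A set squeezed between `[0, τ)` and `[0, τ]` has comparable Lebesgue measure and
`torusLaw`. -/
theorem torusLaw_comparable {A : Set ℝ} {τ : ℝ} (hτ : 0 ≤ τ) (hτ4 : τ ≤ 4)
    (h1 : Set.Ico 0 τ ⊆ A) (h2 : A ⊆ Set.Icc 0 τ) :
    torusLaw A ≤ ENNReal.ofReal (1 / 2) * volume A ∧
      ENNReal.ofReal (1 / Real.pi ^ 2) * volume A ≤ torusLaw A := by
  constructor
  · calc torusLaw A ≤ torusLaw (Set.Iic τ) := measure_mono (h2.trans Set.Icc_subset_Iic_self)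
      _ ≤ ENNReal.ofReal (τ / 2) := torusLaw_Iic_le hτ
      _ = ENNReal.ofReal (1 / 2) * volume (Set.Ico 0 τ) := by
        rw [Real.volume_Ico, ← ENNReal.ofReal_mul (by norm_num)]
        congr 1
        ring
      _ ≤ _ := by gcongr
  · calc _ ≤ ENNReal.ofReal (1 / Real.pi ^ 2) * volume (Set.Icc 0 τ) := by gcongr
      _ = ENNReal.ofReal (τ / Real.pi ^ 2) := by
        rw [Real.volume_Icc, ← ENNReal.ofReal_mul (by positivity)]
        congr 1
        ring
      _ ≤ torusLaw (Set.Iio τ) := le_torusLaw_Iio hτ hτ4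
      _ ≤ torusLaw A := by
        refine measure_mono_ae ?_
        filter_upwards [ae_torusLaw_mem_Icc] with t ht hlt
        exact h1 ⟨ht.1, hlt⟩

/-- Superlevel sets of a decreasing function are initial segments of `[0, 4]`, whose masses under
the law and under Lebesgue measure are comparable. The layer-cake formula integrates this over the
levels. -/
theorem AntitoneOn.integral_torusLaw {f : ℝ → ℝ} (hfm : Measurable f)
    (hf : AntitoneOn f (Set.Icc 0 4)) (hf0 : ∀ t ∈ Set.Icc (0 : ℝ) 4, 0 ≤ f t) :
    Integrable f torusLaw ∧
    ∫ t, f t ∂torusLaw ≤ 1 / 2 * ∫ t in (0 : ℝ)..4, f t ∧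
    1 / Real.pi ^ 2 * ∫ t in (0 : ℝ)..4, f t ≤ ∫ t, f t ∂torusLaw := by
  have hbound : ∀ t ∈ Set.Icc (0 : ℝ) 4, ‖f t‖ ≤ f 0 := fun t ht => by
    rw [Real.norm_eq_abs, abs_of_nonneg (hf0 t ht)]
    exact hf (by norm_num) ht ht.1
  have hi : Integrable f torusLaw :=
    Integrable.of_bound hfm.aestronglyMeasurable (f 0) (ae_torusLaw_mem_Icc.mono hbound)
  have hiv : IntegrableOn f (Set.Icc 0 4) := by
    refine Integrable.of_bound hfm.aestronglyMeasurable (f 0) ?_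
    filter_upwards [ae_restrict_mem measurableSet_Icc] with t ht using hbound t ht
  have hν0 : 0 ≤ᵐ[torusLaw] f := ae_torusLaw_mem_Icc.mono hf0
  have hv0 : 0 ≤ᵐ[volume.restrict (Set.Icc (0 : ℝ) 4)] f := by
    filter_upwards [ae_restrict_mem measurableSet_Icc] with t ht using hf0 t ht
  have hlevel : ∀ s : ℝ,
      torusLaw {t | s < f t} ≤
        ENNReal.ofReal (1 / 2) * volume.restrict (Set.Icc (0 : ℝ) 4) {t | s < f t} ∧
      ENNReal.ofReal (1 / Real.pi ^ 2) * volume.restrict (Set.Icc (0 : ℝ) 4) {t | s < f t} ≤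
        torusLaw {t | s < f t} := fun s => by
    have hms : MeasurableSet {t | s < f t} := measurableSet_lt measurable_const hfm
    set A := {t | s < f t} ∩ Set.Icc (0 : ℝ) 4 with hA
    have e : torusLaw {t | s < f t} = torusLaw A := by
      refine measure_congr ?_
      filter_upwards [ae_torusLaw_mem_Icc] with t ht
      exact propext ⟨fun h => ⟨h, ht⟩, fun h => h.1⟩
    rw [Measure.restrict_apply hms, e]
    rcases A.eq_empty_or_nonempty with hE | ⟨a, ha⟩
    · rw [← hA, hE]; simp
    have hbdd : BddAbove A := ⟨4, fun t ht => ht.2.2⟩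
    refine torusLaw_comparable (τ := sSup A) ?_ ?_ ?_ ?_
    · exact ha.2.1.trans (le_csSup hbdd ha)
    · exact csSup_le ⟨a, ha⟩ fun t ht => ht.2.2
    · rintro t ⟨ht0, ht⟩
      obtain ⟨b, hb, htb⟩ := exists_lt_of_lt_csSup ⟨a, ha⟩ ht
      have ht4 : t ∈ Set.Icc (0 : ℝ) 4 := ⟨ht0, htb.le.trans hb.2.2⟩
      exact ⟨lt_of_lt_of_le (show s < f b from hb.1) (hf ht4 hb.2 htb.le), ht4⟩
    · exact fun t ht => ⟨ht.2.1, le_csSup hbdd ht⟩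
  have hm : ∀ {μ : Measure ℝ}, Measurable fun s => μ {t | s < f t} := fun {μ} =>
    (show Antitone fun s => μ {t | s < f t} from
      fun s s' h => measure_mono fun t ht => lt_of_le_of_lt h ht).measurable
  have h4 : ∫ t in (0 : ℝ)..4, f t = ∫ t in Set.Icc (0 : ℝ) 4, f t := by
    rw [intervalIntegral.integral_of_le (by norm_num), integral_Icc_eq_integral_Ioc]
  have hI0 : 0 ≤ ∫ t in Set.Icc (0 : ℝ) 4, f t := integral_nonneg_of_ae hv0
  have hJ0 : 0 ≤ ∫ t, f t ∂torusLaw := integral_nonneg_of_ae hν0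
  rw [h4]
  refine ⟨hi, ?_, ?_⟩
  · rw [← ENNReal.ofReal_le_ofReal_iff (by positivity), ENNReal.ofReal_mul (by norm_num),
      ofReal_integral_eq_lintegral_ofReal hi hν0, ofReal_integral_eq_lintegral_ofReal hiv hv0,
      lintegral_eq_lintegral_meas_lt _ hν0 hfm.aemeasurable,
      lintegral_eq_lintegral_meas_lt _ hv0 hfm.aemeasurable,
      ← lintegral_const_mul _ hm]
    exact lintegral_mono fun s => (hlevel s).1
  · rw [← ENNReal.ofReal_le_ofReal_iff hJ0, ENNReal.ofReal_mul (by positivity),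
      ofReal_integral_eq_lintegral_ofReal hi hν0, ofReal_integral_eq_lintegral_ofReal hiv hv0,
      lintegral_eq_lintegral_meas_lt _ hν0 hfm.aemeasurable,
      lintegral_eq_lintegral_meas_lt _ hv0 hfm.aemeasurable,
      ← lintegral_const_mul _ hm]
    exact lintegral_mono fun s => (hlevel s).2

/-! ### Asymptotics of the negative power means -/

/-- `A` is at most a multiple of `f` on `(0, ∞)`, and at least a multiple of `f` on every
`(0, T]`. -/
def ComparableNearZero (A f : ℝ → ℝ) : Prop :=
  (∃ K > 0, ∀ c, 0 < c → A c ≤ K * f c) ∧ ∀ T, ∃ k > 0, ∀ c, 0 < c → c ≤ T → k * f c ≤ A c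

/-- The mean of `(t ^ γ + c) ^ (-α)` under `torusLaw`. -/
noncomputable def powMean (γ α c : ℝ) : ℝ := ∫ t, (t ^ γ + c) ^ (-α) ∂torusLaw

section

variable {γ α c : ℝ}

theorem measurable_powMean_integrand (γ α c : ℝ) : Measurable fun t : ℝ => (t ^ γ + c) ^ (-α) := by
  fun_prop

theorem antitoneOn_powMean_integrand (hγ : 0 < γ) (hα : 0 < α) (hc : 0 < c) :
    AntitoneOn (fun t : ℝ => (t ^ γ + c) ^ (-α)) (Set.Icc 0 4) := fun x hx y _ hxy => by
  have h1 : 0 ≤ x ^ γ := Real.rpow_nonneg hx.1 _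
  have h2 : x ^ γ ≤ y ^ γ := Real.rpow_le_rpow hx.1 hxy hγ.le
  exact Real.rpow_le_rpow_of_nonpos (by linarith) (by linarith) (by linarith)

theorem powMean_integrand_nonneg (hc : 0 < c) (t : ℝ) (ht : t ∈ Set.Icc (0 : ℝ) 4) :
    0 ≤ (t ^ γ + c) ^ (-α) :=
  Real.rpow_nonneg (by have := Real.rpow_nonneg ht.1 γ; linarith) _

theorem integrable_powMean_integrand (hγ : 0 < γ) (hα : 0 < α) (hc : 0 < c) :
    Integrable (fun t : ℝ => (t ^ γ + c) ^ (-α)) torusLaw :=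
  ((antitoneOn_powMean_integrand hγ hα hc).integral_torusLaw (measurable_powMean_integrand γ α c)
    (powMean_integrand_nonneg hc)).1

theorem powMean_le (hγ : 0 < γ) (hα : 0 < α) (hc : 0 < c) : powMean γ α c ≤ c ^ (-α) := by
  have h : powMean γ α c ≤ ∫ _, c ^ (-α) ∂torusLaw := by
    refine integral_mono_ae (integrable_powMean_integrand hγ hα hc) (integrable_const _) ?_
    filter_upwards [ae_torusLaw_mem_Icc] with t ht
    have := Real.rpow_nonneg ht.1 γ
    exact Real.rpow_le_rpow_of_nonpos hc (by linarith) (by linarith)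
  simpa using h

theorem le_powMean (hγ : 0 < γ) (hα : 0 < α) (hc : 0 < c) :
    (4 ^ γ + c) ^ (-α) ≤ powMean γ α c := by
  have h : ∫ _, (4 ^ γ + c) ^ (-α) ∂torusLaw ≤ powMean γ α c := by
    refine integral_mono_ae (integrable_const _) (integrable_powMean_integrand hγ hα hc) ?_
    filter_upwards [ae_torusLaw_mem_Icc] with t ht
    exact antitoneOn_powMean_integrand hγ hα hc ht (by norm_num) ht.2
  simpa using h

theorem powMean_pos (hγ : 0 < γ) (hα : 0 < α) (hc : 0 < c) : 0 < powMean γ α c :=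
  lt_of_lt_of_le (by positivity) (le_powMean hγ hα hc)

/-- With `s = c ^ (1/γ)`, one has `((t + s) / 2) ^ γ ≤ t ^ γ + c ≤ 2 * (t + s) ^ γ`, which replaces
the integrand by one with an elementary primitive. -/
theorem powMean_comparable (hγ : 0 < γ) (hα : 0 < α) : ∃ k > 0, ∃ K > 0, ∀ c, 0 < c →
    k * (∫ t in (0 : ℝ)..4, (t + c ^ (1 / γ)) ^ (-(α * γ))) ≤ powMean γ α c ∧
    powMean γ α c ≤ K * ∫ t in (0 : ℝ)..4, (t + c ^ (1 / γ)) ^ (-(α * γ)) := by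
  refine ⟨1 / Real.pi ^ 2 * 2 ^ (-α), by positivity, 1 / 2 * 2 ^ (α * γ), by positivity,
    fun c hc => ?_⟩
  set s := c ^ (1 / γ) with hs
  have hs0 : 0 < s := Real.rpow_pos_of_pos hc _
  have hsγ : s ^ γ = c := by
    rw [hs, ← Real.rpow_mul hc.le, one_div_mul_cancel hγ.ne', Real.rpow_one]
  obtain ⟨-, h1, h2⟩ := (antitoneOn_powMean_integrand hγ hα hc).integral_torusLaw
    (measurable_powMean_integrand γ α c) (powMean_integrand_nonneg hc)
  have hle : ∀ t ∈ Set.Icc (0 : ℝ) 4,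
      2 ^ (-α) * (t + s) ^ (-(α * γ)) ≤ (t ^ γ + c) ^ (-α) ∧
      (t ^ γ + c) ^ (-α) ≤ 2 ^ (α * γ) * (t + s) ^ (-(α * γ)) := fun t ht => by
    have ht0 := ht.1
    have hp : 0 < t ^ γ + c := by have := Real.rpow_nonneg ht0 γ; linarith
    have h1 : t ^ γ ≤ (t + s) ^ γ := Real.rpow_le_rpow ht0 (by linarith) hγ.le
    have h2 : c ≤ (t + s) ^ γ := by
      rw [← hsγ]; exact Real.rpow_le_rpow hs0.le (by linarith) hγ.le
    constructor
    · have e : (2 : ℝ) ^ (-α) * (t + s) ^ (-(α * γ)) = (2 * (t + s) ^ γ) ^ (-α) := by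
        rw [Real.mul_rpow (by norm_num) (by positivity), ← Real.rpow_mul (by positivity)]
        congr 2
        ring
      rw [e]
      exact Real.rpow_le_rpow_of_nonpos hp (by linarith) (by linarith)
    · have e : (2 : ℝ) ^ (α * γ) * (t + s) ^ (-(α * γ)) = (((t + s) / 2) ^ γ) ^ (-α) := by
        rw [← Real.rpow_mul (by positivity), Real.div_rpow (by positivity) (by norm_num),
          show γ * -α = -(α * γ) by ring, Real.rpow_neg (by norm_num : (0 : ℝ) ≤ 2), div_inv_eq_mul,
          mul_comm]
      rw [e]
      refine Real.rpow_le_rpow_of_nonpos (by positivity) ?_ (by linarith)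
      rcases le_total t s with hts | hts
      · have : ((t + s) / 2) ^ γ ≤ s ^ γ := Real.rpow_le_rpow (by positivity) (by linarith) hγ.le
        linarith [Real.rpow_nonneg ht0 γ]
      · have : ((t + s) / 2) ^ γ ≤ t ^ γ := Real.rpow_le_rpow (by positivity) (by linarith) hγ.le
        linarith
  have hi1 : IntervalIntegrable (fun t : ℝ => (t ^ γ + c) ^ (-α)) volume 0 4 := by
    refine ContinuousOn.intervalIntegrable ?_
    rw [Set.uIcc_of_le (by norm_num)]
    intro t ht
    refine ContinuousAt.continuousWithinAt ?_
    have hp : 0 < t ^ γ + c := by have := Real.rpow_nonneg ht.1 γ; linarith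
    exact ((Real.continuous_rpow_const hγ.le).continuousAt.add continuousAt_const).rpow_const
      (Or.inl hp.ne')
  have hi2 : IntervalIntegrable (fun t : ℝ => (t + s) ^ (-(α * γ))) volume 0 4 := by
    refine ContinuousOn.intervalIntegrable ?_
    rw [Set.uIcc_of_le (by norm_num)]
    intro t ht
    refine ContinuousAt.continuousWithinAt ?_
    exact (continuousAt_id.add continuousAt_const).rpow_const
      (Or.inl (show t + s ≠ 0 by have := ht.1; positivity))
  have h3 := intervalIntegral.integral_mono_on (by norm_num) (hi2.const_mul (2 ^ (-α))) hi1
    fun t ht => (hle t ht).1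
  have h4 := intervalIntegral.integral_mono_on (by norm_num) hi1 (hi2.const_mul (2 ^ (α * γ)))
    fun t ht => (hle t ht).2
  rw [intervalIntegral.integral_const_mul] at h3 h4
  constructor
  · refine le_trans ?_ h2
    rw [mul_assoc]
    gcongr
  · refine h1.trans ?_
    rw [mul_assoc]
    gcongr

theorem integral_add_rpow {s : ℝ} (hs : 0 < s) {β : ℝ} (hβ : β ≠ 1) :
    ∫ t in (0 : ℝ)..4, (t + s) ^ (-β) = ((4 + s) ^ (1 - β) - s ^ (1 - β)) / (1 - β) := by
  rw [intervalIntegral.integral_comp_add_right (fun t => t ^ (-β)) s, integral_rpow]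
  · rw [zero_add, neg_add_eq_sub]
  · right
    refine ⟨fun h => hβ (by linarith), ?_⟩
    rw [Set.uIcc_of_le (by linarith)]
    exact fun h => by linarith [h.1]

theorem integral_add_inv {s : ℝ} (hs : 0 < s) :
    ∫ t in (0 : ℝ)..4, (t + s) ^ (-1 : ℝ) = Real.log ((4 + s) / s) := by
  rw [intervalIntegral.integral_comp_add_right (fun t => t ^ (-1 : ℝ)) s]
  simp only [Real.rpow_neg_one]
  rw [integral_inv, zero_add]
  rw [Set.uIcc_of_le (by linarith)]
  exact fun h => by linarith [h.1]

theorem rpow_inv_le_of_le (hγ : 0 < γ) {T : ℝ} (hc : 0 < c) (hT : c ≤ T) :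
    c ^ (1 / γ) ≤ T ^ (1 / γ) :=
  Real.rpow_le_rpow hc.le hT (by positivity)

theorem ComparableNearZero.of_pos {A f : ℝ → ℝ} (h1 : ∃ K > 0, ∀ c, 0 < c → A c ≤ K * f c)
    (h2 : ∀ T, 0 < T → ∃ k > 0, ∀ c, 0 < c → c ≤ T → k * f c ≤ A c) : ComparableNearZero A f := by
  refine ⟨h1, fun T => ?_⟩
  obtain ⟨k, hk, h⟩ := h2 (max T 1) (by positivity)
  exact ⟨k, hk, fun c hc hcT => h c hc (hcT.trans (le_max_left _ _))⟩

theorem powMean_comparableNearZero_of_one_lt (hγ : 0 < γ) (hα : 0 < α) (hβ : 1 < α * γ) :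
    ComparableNearZero (powMean γ α) fun c => c ^ (1 / γ - α) := by
  obtain ⟨k, hk, K, hK, h⟩ := powMean_comparable hγ hα
  have hexp : ∀ c : ℝ, 0 < c → (c ^ (1 / γ)) ^ (1 - α * γ) = c ^ (1 / γ - α) := fun c hc => by
    rw [← Real.rpow_mul hc.le]
    congr 1
    field_simp
  have hβ' : 0 < α * γ - 1 := by linarith
  have hform : ∀ c : ℝ, 0 < c → ∫ t in (0 : ℝ)..4, (t + c ^ (1 / γ)) ^ (-(α * γ)) =
      (c ^ (1 / γ - α) - (4 + c ^ (1 / γ)) ^ (1 - α * γ)) / (α * γ - 1) := fun c hc => by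
    rw [integral_add_rpow (by positivity) hβ.ne', hexp c hc, ← neg_sub, ← neg_sub (α * γ) 1,
      neg_div_neg_eq]
  refine .of_pos ⟨K / (α * γ - 1), by positivity, fun c hc => ?_⟩ fun T hT => ?_
  · refine (h c hc).2.trans ?_
    rw [hform c hc, mul_div_assoc', div_mul_eq_mul_div]
    gcongr
    have : 0 ≤ (4 + c ^ (1 / γ)) ^ (1 - α * γ) := by positivity
    linarith
  · set S := T ^ (1 / γ) with hS
    have hS0 : 0 < S := by positivity
    -- For `s ≤ S` the subtracted endpoint term is at most the fraction `ρ < 1` of the main term `s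
    -- ^ (1 - αγ)`, so a fixed share survives.
    set ρ := ((4 + S) / S) ^ (1 - α * γ) with hρ
    have hρ1 : ρ < 1 := Real.rpow_lt_one_of_one_lt_of_neg
      (by rw [one_lt_div hS0]; linarith) (by linarith)
    refine ⟨k * ((1 - ρ) / (α * γ - 1)), mul_pos hk (div_pos (by linarith) hβ'),
      fun c hc hcT => le_trans ?_ (h c hc).1⟩
    rw [hform c hc, mul_assoc, div_mul_eq_mul_div]
    gcongr
    set s := c ^ (1 / γ) with hs
    have hs0 : 0 < s := by positivity
    have hsS : s ≤ S := rpow_inv_le_of_le hγ hc hcT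
    have h1 : (4 + s) ^ (1 - α * γ) = ((4 + s) / s) ^ (1 - α * γ) * s ^ (1 - α * γ) := by
      rw [← Real.mul_rpow (by positivity) (by positivity), div_mul_cancel₀ _ hs0.ne']
    have h2 : ((4 + s) / s) ^ (1 - α * γ) ≤ ρ := by
      refine Real.rpow_le_rpow_of_nonpos (by positivity) ?_ (by linarith)
      rw [div_le_div_iff₀ hS0 hs0]
      nlinarith
    rw [h1, hexp c hc]
    have : 0 ≤ c ^ (1 / γ - α) := by positivity
    nlinarith

theorem powMean_comparableNearZero_of_eq_one (hγ : 0 < γ) (hα : 0 < α) (hβ : α * γ = 1) :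
    ComparableNearZero (powMean γ α) fun c => 1 + |Real.log c| := by
  obtain ⟨k, hk, K, hK, h⟩ := powMean_comparable hγ hα
  rw [hβ] at h
  have hlog : ∀ c : ℝ, 0 < c → Real.log c = γ * Real.log (c ^ (1 / γ)) := fun c hc => by
    rw [Real.log_rpow hc, ← mul_assoc, mul_one_div_cancel hγ.ne', one_mul]
  refine .of_pos ⟨K * (Real.log 5 + 1 + 1 / γ), ?_, fun c hc => ?_⟩ fun T hT => ?_
  · have := Real.log_pos (by norm_num : (1 : ℝ) < 5)
    positivity
  · refine (h c hc).2.trans ?_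
    rw [integral_add_inv (by positivity), mul_assoc]
    gcongr
    have h5 := Real.log_pos (by norm_num : (1 : ℝ) < 5)
    set s := c ^ (1 / γ) with hs
    have hs0 : 0 < s := by positivity
    have habs : 1 / γ * |Real.log c| = |Real.log s| := by
      rw [hlog c hc, abs_mul, abs_of_pos hγ, ← hs]
      field_simp
    -- For `s ≤ 1` the numerator is at most `5`; for `s ≥ 1` the whole quotient is.
    have key : Real.log ((4 + s) / s) ≤ Real.log 5 + |Real.log s| := by
      rcases le_total s 1 with h1 | h1
      · rw [Real.log_div (by positivity) hs0.ne']
        have := Real.log_le_log (by positivity : 0 < 4 + s) (by linarith : 4 + s ≤ 5)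
        linarith [neg_le_abs (Real.log s)]
      · have : Real.log ((4 + s) / s) ≤ Real.log 5 := by
          refine Real.log_le_log (by positivity) ?_
          rw [div_le_iff₀ hs0]
          linarith
        linarith [abs_nonneg (Real.log s)]
    have : 0 < 1 / γ := by positivity
    nlinarith [abs_nonneg (Real.log c)]
  · set S := T ^ (1 / γ) with hS
    have hS0 : 0 < S := by positivity
    set m := Real.log ((4 + S) / S) with hm
    have hm0 : 0 < m := Real.log_pos (by rw [one_lt_div hS0]; linarith)
    -- Chosen so that `1 + γ |log s| ≤ D * ℓ`, from `|log s| ≤ ℓ + 2 |log S|` and `m ≤ ℓ`.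
    set D := γ + (1 + 2 * γ * |Real.log S|) / m with hD
    have hD0 : 0 < D := by positivity
    refine ⟨k / D, by positivity, fun c hc hcT => le_trans ?_ (h c hc).1⟩
    rw [integral_add_inv (by positivity), div_mul_eq_mul_div, mul_div_assoc]
    gcongr
    rw [div_le_iff₀ hD0]
    set s := c ^ (1 / γ) with hs
    have hs0 : 0 < s := by positivity
    have hsS : s ≤ S := rpow_inv_le_of_le hγ hc hcT
    set ℓ := Real.log ((4 + s) / s) with hℓ
    have h1 : m ≤ ℓ := by
      refine Real.log_le_log (by positivity) ?_
      rw [div_le_div_iff₀ hS0 hs0]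
      nlinarith
    have h2 : -Real.log s ≤ ℓ := by
      rw [← Real.log_inv]
      refine Real.log_le_log (by positivity) ?_
      rw [inv_eq_one_div]
      gcongr
      linarith
    have h3 : Real.log s ≤ Real.log S := Real.log_le_log hs0 hsS
    have h4 : |Real.log s| ≤ ℓ + 2 * |Real.log S| := by
      rw [abs_le]
      have := le_abs_self (Real.log S)
      have := abs_nonneg (Real.log S)
      constructor <;> linarith
    have h5 : (1 + 2 * γ * |Real.log S|) ≤ ℓ * ((1 + 2 * γ * |Real.log S|) / m) := by
      rw [mul_div_assoc', le_div_iff₀ hm0, mul_comm]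
      gcongr
    rw [hlog c hc, abs_mul, abs_of_pos hγ, hD]
    nlinarith

/-- The exponent `1 - αγ` lies in `(0, 1)`, and subadditivity of that power bounds the integral
uniformly in `c`. -/
theorem powMean_comparableNearZero_of_lt_one (hγ : 0 < γ) (hα : 0 < α) (hβ : α * γ < 1) :
    ComparableNearZero (powMean γ α) fun _ => 1 := by
  obtain ⟨k, hk, K, hK, h⟩ := powMean_comparable hγ hα
  have hβ' : 0 < 1 - α * γ := by linarith
  refine .of_pos ⟨K * (4 ^ (1 - α * γ) / (1 - α * γ)), by positivity, fun c hc => ?_⟩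
    fun T hT => ⟨(4 ^ γ + T) ^ (-α), by positivity, fun c hc hcT => ?_⟩
  · refine (h c hc).2.trans ?_
    rw [integral_add_rpow (by positivity) hβ.ne, mul_one]
    gcongr
    have := Real.rpow_add_le_add_rpow (p := 1 - α * γ) (by norm_num : (0 : ℝ) ≤ 4)
      (by positivity : 0 ≤ c ^ (1 / γ)) hβ'.le (by have : 0 < α * γ := by positivity
                                                   linarith)
    linarith
  · rw [mul_one]
    refine le_trans ?_ (le_powMean hγ hα hc)
    exact Real.rpow_le_rpow_of_nonpos (by positivity) (by linarith) (by linarith)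

end

/-! ### The mean root, its inverse and their derivatives -/

/-- The mean of `√(2 * (t ^ γ + c))` under `torusLaw`. -/
noncomputable def meanRoot (γ c : ℝ) : ℝ := ∫ t, √(2 * (t ^ γ + c)) ∂torusLaw

section

variable {γ : ℝ}

theorem rpow_le_add_rpow_of_mem_Icc {a b x r : ℝ} (ha : 0 < a) (hx : x ∈ Set.Icc a b) :
    x ^ r ≤ a ^ r + b ^ r := by
  have hx0 : 0 < x := ha.trans_le hx.1
  have h1 : 0 ≤ a ^ r := by positivity
  have h2 : 0 ≤ b ^ r := Real.rpow_nonneg (hx0.le.trans hx.2) _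
  rcases le_total 0 r with hr | hr
  · linarith [Real.rpow_le_rpow hx0.le hx.2 hr]
  · linarith [Real.rpow_le_rpow_of_nonpos ha hx.1 hr]

theorem rpow_add_mem_Icc (hγ : 0 < γ) {t c : ℝ} (ht : t ∈ Set.Icc (0 : ℝ) 4) :
    t ^ γ + c ∈ Set.Icc c (4 ^ γ + c) := by
  have h1 := Real.rpow_nonneg ht.1 γ
  have h2 := Real.rpow_le_rpow ht.1 ht.2 hγ.le
  constructor <;> linarith

/-- Differentiation under the integral. The dominating constant adds the powers at both ends of the
range of `t ^ γ + x`, so it serves either sign of the exponent; `α = -1/2` yields the derivative of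
the mean root. -/
theorem hasDerivAt_powMean (hγ : 0 < γ) (α : ℝ) {c : ℝ} (hc : 0 < c) :
    HasDerivAt (powMean γ α) (-α * powMean γ (α + 1) c) c := by
  have key := (hasDerivAt_integral_of_dominated_loc_of_deriv_le (μ := torusLaw)
    (F := fun c t => (t ^ γ + c) ^ (-α)) (F' := fun c t => 1 * -α * (t ^ γ + c) ^ (-α - 1))
    (x₀ := c) (s := Set.Ioo (c / 2) (2 * c))
    (bound := fun _ => |α| * ((c / 2) ^ (-α - 1) + (4 ^ γ + 2 * c) ^ (-α - 1)))
    (Ioo_mem_nhds (by linarith) (by linarith))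
    (Eventually.of_forall fun c => (measurable_powMean_integrand γ α c).aestronglyMeasurable)
    ?_ ((((measurable_id.pow_const γ).add_const c).pow_const _).const_mul _).aestronglyMeasurable
    ?_ (integrable_const _) ?_).2
  · refine key.congr_deriv ?_
    rw [powMean, ← integral_const_mul]
    congr 1
    funext t
    rw [neg_add']
    ring
  · refine Integrable.of_bound (measurable_powMean_integrand γ α c).aestronglyMeasurable
      (c ^ (-α) + (4 ^ γ + c) ^ (-α)) ?_
    filter_upwards [ae_torusLaw_mem_Icc] with t ht
    have h := rpow_add_mem_Icc hγ (c := c) ht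
    rw [Real.norm_eq_abs, abs_of_nonneg (Real.rpow_nonneg (hc.le.trans h.1) _)]
    exact rpow_le_add_rpow_of_mem_Icc hc h
  · filter_upwards [ae_torusLaw_mem_Icc] with t ht x hx
    have h := rpow_add_mem_Icc hγ (c := x) ht
    have hx1 := hx.1
    have hx2 := hx.2
    have h0 : 0 ≤ (t ^ γ + x) ^ (-α - 1) := Real.rpow_nonneg (by linarith [h.1]) _
    rw [one_mul, norm_mul, norm_neg, Real.norm_eq_abs, Real.norm_eq_abs, abs_of_nonneg h0]
    refine mul_le_mul_of_nonneg_left ?_ (abs_nonneg α)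
    exact rpow_le_add_rpow_of_mem_Icc (by positivity) ⟨by linarith [h.1], by linarith [h.2]⟩
  · filter_upwards [ae_torusLaw_mem_Icc] with t ht x hx
    have h := rpow_add_mem_Icc hγ (c := x) ht
    have hx1 := hx.1
    exact ((hasDerivAt_id x).const_add (t ^ γ)).rpow_const (Or.inl (by
      have : 0 < t ^ γ + x := by linarith [h.1]
      exact this.ne'))

theorem hasDerivAt_meanRoot (hγ : 0 < γ) {c : ℝ} (hc : 0 < c) :
    HasDerivAt (meanRoot γ) (powMean γ (1 / 2) c / √2) c := by
  have h := (hasDerivAt_powMean hγ (-(1 / 2)) hc).const_mul √2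
  have e : meanRoot γ = fun c => √2 * powMean γ (-(1 / 2)) c := by
    funext c
    rw [meanRoot, powMean, ← integral_const_mul]
    congr 1
    funext t
    rw [Real.sqrt_mul (by norm_num), Real.sqrt_eq_rpow (t ^ γ + c), neg_neg]
  rw [e]
  refine h.congr_deriv (Eq.symm ?_)
  rw [show -(1 / 2 : ℝ) + 1 = 1 / 2 by norm_num, div_eq_iff (by positivity)]
  have := Real.mul_self_sqrt (show (0 : ℝ) ≤ 2 by norm_num)
  linear_combination -(powMean γ (1 / 2) c / 2) * this

theorem continuous_meanRoot_integrand (hγ : 0 < γ) (c : ℝ) :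
    Continuous fun t : ℝ => √(2 * (t ^ γ + c)) := by
  have := Real.continuous_rpow_const hγ.le
  fun_prop

theorem meanRoot_integrand_le (hγ : 0 < γ) {c C t : ℝ} (hcC : c ≤ C) (ht : t ∈ Set.Icc (0 : ℝ) 4) :
    ‖√(2 * (t ^ γ + c))‖ ≤ √(2 * (4 ^ γ + C)) := by
  rw [Real.norm_eq_abs, abs_of_nonneg (Real.sqrt_nonneg _)]
  have := Real.rpow_le_rpow ht.1 ht.2 hγ.le
  exact Real.sqrt_le_sqrt (by linarith)

theorem integrable_meanRoot_integrand (hγ : 0 < γ) (c : ℝ) :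
    Integrable (fun t : ℝ => √(2 * (t ^ γ + c))) torusLaw :=
  Integrable.of_bound (continuous_meanRoot_integrand hγ c).aestronglyMeasurable _
    (ae_torusLaw_mem_Icc.mono fun _ ht => meanRoot_integrand_le hγ le_rfl ht)

theorem continuous_meanRoot (hγ : 0 < γ) : Continuous (meanRoot γ) := by
  refine continuous_iff_continuousAt.2 fun c => ?_
  refine continuousAt_of_dominated (bound := fun _ => √(2 * (4 ^ γ + (c + 1))))
    (Eventually.of_forall fun c => (continuous_meanRoot_integrand hγ c).aestronglyMeasurable) ?_
    (integrable_const _) (Eventually.of_forall fun t => by fun_prop)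
  filter_upwards [gt_mem_nhds (show c < c + 1 by linarith)] with x hx
  filter_upwards [ae_torusLaw_mem_Icc] with t ht using meanRoot_integrand_le hγ (le_of_lt hx) ht

theorem strictMonoOn_meanRoot (hγ : 0 < γ) : StrictMonoOn (meanRoot γ) (Set.Ici 0) := by
  refine strictMonoOn_of_deriv_pos (convex_Ici 0) (continuous_meanRoot hγ).continuousOn fun c hc => ?_
  rw [interior_Ici] at hc
  rw [(hasDerivAt_meanRoot hγ hc).deriv]
  exact div_pos (powMean_pos hγ (by norm_num) hc) (by positivity)

theorem sqrt_le_meanRoot (hγ : 0 < γ) (c : ℝ) : √(2 * c) ≤ meanRoot γ c := by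
  have h : ∫ _, √(2 * c) ∂torusLaw ≤ meanRoot γ c := by
    refine integral_mono_ae (integrable_const _) (integrable_meanRoot_integrand hγ c) ?_
    filter_upwards [ae_torusLaw_mem_Icc] with t ht
    have := Real.rpow_nonneg ht.1 γ
    exact Real.sqrt_le_sqrt (by linarith)
  simpa using h

/-- The law has no mass on `(-∞, 0]`, and the root is positive elsewhere. -/
theorem meanRoot_zero_pos (hγ : 0 < γ) : 0 < meanRoot γ 0 := by
  refine (integral_pos_iff_support_of_nonneg (fun t => Real.sqrt_nonneg _)
    (integrable_meanRoot_integrand hγ 0)).2 ?_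
  have hsub : Set.Ioi (0 : ℝ) ⊆ Function.support fun t : ℝ => √(2 * (t ^ γ + 0)) := fun t ht => by
    have ht : 0 < t := ht
    have : 0 < √(2 * (t ^ γ + 0)) := by positivity
    exact this.ne'
  refine lt_of_lt_of_le ?_ (measure_mono hsub)
  have h1 : torusLaw (Set.Iic 0) = 0 := by
    have := torusLaw_Iic_le (le_refl (0 : ℝ))
    simpa using this
  have h2 := prob_compl_eq_one_sub (μ := torusLaw) (measurableSet_Iic (a := (0 : ℝ)))
  rw [Set.compl_Iic, h1] at h2
  rw [h2]
  simp

theorem exists_meanRoot_eq (hγ : 0 < γ) {y : ℝ} (hy : meanRoot γ 0 ≤ y) :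
    ∃ c, 0 ≤ c ∧ meanRoot γ c = y := by
  have h0 := (meanRoot_zero_pos hγ).trans_le hy
  have h1 : y ≤ meanRoot γ (y ^ 2 / 2) := by
    have := sqrt_le_meanRoot hγ (y ^ 2 / 2)
    rwa [mul_div_cancel₀ _ two_ne_zero, Real.sqrt_sq h0.le] at this
  obtain ⟨c, hc, h⟩ := intermediate_value_Icc (by positivity : 0 ≤ y ^ 2 / 2)
    (continuous_meanRoot hγ).continuousOn ⟨hy, h1⟩
  exact ⟨c, hc.1, h⟩

/-- Strict monotonicity of the mean root gives uniqueness; its lower bound `√(2c)` and continuity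
give existence above the threshold. -/
theorem existsUnique_effective (hγ : 0 < γ) (p : ℝ) :
    ∃! c : ℝ, 0 ≤ c ∧ |p| ≤ meanRoot γ c ∧ (0 < c → meanRoot γ c = |p|) := by
  rcases le_total |p| (meanRoot γ 0) with h | h
  · refine ⟨0, ⟨le_rfl, h, fun h => absurd h (lt_irrefl _)⟩, ?_⟩
    rintro c ⟨hc, -, hc2⟩
    by_contra hne
    have hc0 : 0 < c := lt_of_le_of_ne hc (Ne.symm hne)
    have := strictMonoOn_meanRoot hγ (le_refl (0 : ℝ)) hc hc0
    linarith [hc2 hc0]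
  · obtain ⟨c, hc, hcp⟩ := exists_meanRoot_eq hγ h
    refine ⟨c, ⟨hc, hcp.ge, fun _ => hcp⟩, ?_⟩
    rintro d ⟨hd, hd1, hd2⟩
    rcases hd.eq_or_lt with rfl | hd0
    · exact (strictMonoOn_meanRoot hγ).injOn (le_refl (0 : ℝ)) hc (by linarith)
    · exact (strictMonoOn_meanRoot hγ).injOn hd hc ((hd2 hd0).trans hcp.symm)

/-- `H` is `0` where `|p| ≤ meanRoot γ 0`, and inverse to `meanRoot γ` beyond. -/
def IsFlatInverse (γ : ℝ) (H : ℝ → ℝ) : Prop :=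
  ∀ p, 0 ≤ H p ∧ |p| ≤ meanRoot γ (H p) ∧ (0 < H p → meanRoot γ (H p) = |p|)

namespace IsFlatInverse

variable {H : ℝ → ℝ} (hH : IsFlatInverse γ H) (hγ : 0 < γ)
include hH hγ

theorem eq_zero {p : ℝ} (hp : |p| ≤ meanRoot γ 0) : H p = 0 :=
  (existsUnique_effective hγ p).unique (hH p) ⟨le_rfl, hp, fun h => absurd h (lt_irrefl _)⟩

theorem meanRoot_eq {p : ℝ} (hp : meanRoot γ 0 ≤ p) : meanRoot γ (H p) = p := by
  have hp0 : |p| = p := abs_of_pos ((meanRoot_zero_pos hγ).trans_le hp)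
  obtain ⟨h1, h2, h3⟩ := hH p
  rcases h1.eq_or_lt with h | h
  · rw [hp0, ← h] at h2
    rw [← h]
    exact le_antisymm hp h2
  · rw [h3 h, hp0]

theorem apply_meanRoot {c : ℝ} (hc : 0 ≤ c) : H (meanRoot γ c) = c := by
  have h := (strictMonoOn_meanRoot hγ).monotoneOn (le_refl (0 : ℝ)) hc hc
  exact (strictMonoOn_meanRoot hγ).injOn (hH _).1 hc (hH.meanRoot_eq hγ h)

theorem even (p : ℝ) : H (-p) = H p :=
  (existsUnique_effective hγ p).unique (by have := hH (-p); rwa [abs_neg] at this) (hH p)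

theorem strictMonoOn : StrictMonoOn H (Set.Ici (meanRoot γ 0)) := fun p hp q hq hpq => by
  rw [← (strictMonoOn_meanRoot hγ).lt_iff_lt (hH p).1 (hH q).1, hH.meanRoot_eq hγ hp,
    hH.meanRoot_eq hγ hq]
  exact hpq

theorem pos {p : ℝ} (hp : meanRoot γ 0 < p) : 0 < H p := by
  have := hH.strictMonoOn hγ (le_refl (meanRoot γ 0)) hp.le hp
  rwa [hH.apply_meanRoot hγ le_rfl] at this

/-- A strictly monotone function whose image is an interval is continuous; this supplies the image.
-/
theorem image_Ici : H '' Set.Ici (meanRoot γ 0) = Set.Ici 0 := by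
  refine Set.Subset.antisymm (Set.image_subset_iff.2 fun p _ => (hH p).1) fun c hc => ?_
  exact ⟨meanRoot γ c, (strictMonoOn_meanRoot hγ).monotoneOn (le_refl (0 : ℝ)) hc hc,
    hH.apply_meanRoot hγ hc⟩

theorem continuousAt {p : ℝ} (hp : meanRoot γ 0 < p) : ContinuousAt H p :=
  (hH.strictMonoOn hγ).continuousAt_of_image_mem_nhds (Ici_mem_nhds hp)
    (by rw [hH.image_Ici hγ]; exact Ici_mem_nhds (hH.pos hγ hp))

theorem continuousWithinAt : ContinuousWithinAt H (Set.Ici (meanRoot γ 0)) (meanRoot γ 0) :=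
  (hH.strictMonoOn hγ).continuousWithinAt_right_of_image_mem_nhdsWithin self_mem_nhdsWithin
    (by rw [hH.image_Ici hγ, hH.apply_meanRoot hγ le_rfl]; exact self_mem_nhdsWithin)

theorem hasDerivAt {p : ℝ} (hp : meanRoot γ 0 < p) :
    HasDerivAt H (√2 / powMean γ (1 / 2) (H p)) p := by
  have hpos := powMean_pos hγ (α := 1 / 2) (by norm_num) (hH.pos hγ hp)
  have h := HasDerivAt.of_local_left_inverse (hH.continuousAt hγ hp)
    (hasDerivAt_meanRoot hγ (hH.pos hγ hp)) (div_pos hpos (by positivity)).ne' (by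
      filter_upwards [lt_mem_nhds hp] with q hq using hH.meanRoot_eq hγ (le_of_lt hq))
  rwa [inv_div] at h

theorem eventuallyEq_deriv {p : ℝ} (hp : meanRoot γ 0 < p) :
    deriv H =ᶠ[𝓝 p] fun q => √2 / powMean γ (1 / 2) (H q) := by
  filter_upwards [lt_mem_nhds hp] with q hq using (hH.hasDerivAt hγ hq).deriv

theorem hasDerivAt_deriv {p : ℝ} (hp : meanRoot γ 0 < p) :
    HasDerivAt (deriv H) (powMean γ (3 / 2) (H p) / powMean γ (1 / 2) (H p) ^ 3) p := by
  have hpos := powMean_pos hγ (α := 1 / 2) (by norm_num) (hH.pos hγ hp)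
  have h1 := ((hasDerivAt_powMean hγ (1 / 2) (hH.pos hγ hp)).comp p (hH.hasDerivAt hγ hp))
  have h2 := ((hasDerivAt_const p √2).div h1 hpos.ne').congr_of_eventuallyEq
    (hH.eventuallyEq_deriv hγ hp)
  refine h2.congr_deriv (Eq.symm ?_)
  rw [show (1 / 2 : ℝ) + 1 = 3 / 2 by norm_num]
  have := Real.mul_self_sqrt (show (0 : ℝ) ≤ 2 by norm_num)
  simp only [Function.comp]
  field_simp
  linear_combination (-powMean γ (3 / 2) (H p)) * this

theorem contDiffOn : ContDiffOn ℝ 2 H (Set.Ioi (meanRoot γ 0)) := by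
  rw [show (2 : WithTop ℕ∞) = 1 + 1 from rfl, contDiffOn_succ_iff_deriv_of_isOpen isOpen_Ioi]
  refine ⟨fun p hp => (hH.hasDerivAt hγ hp).differentiableAt.differentiableWithinAt, by simp, ?_⟩
  rw [show (1 : WithTop ℕ∞) = 0 + 1 from rfl, contDiffOn_succ_iff_deriv_of_isOpen isOpen_Ioi]
  refine ⟨fun p hp => (hH.hasDerivAt_deriv hγ hp).differentiableAt.differentiableWithinAt,
    by simp, ?_⟩
  rw [contDiffOn_zero]
  intro p hp
  refine ContinuousAt.continuousWithinAt ?_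
  have hc : ∀ α, ContinuousAt (fun q => powMean γ α (H q)) p := fun α =>
    ContinuousAt.comp (g := powMean γ α) (hasDerivAt_powMean hγ α (hH.pos hγ hp)).continuousAt
      (hH.continuousAt hγ hp)
  have hpos := powMean_pos hγ (α := 1 / 2) (by norm_num) (hH.pos hγ hp)
  refine ((hc (3 / 2)).div ((hc (1 / 2)).pow 3) (pow_pos hpos 3).ne').congr ?_
  filter_upwards [lt_mem_nhds hp] with q hq using (hH.hasDerivAt_deriv hγ hq).deriv.symm

/-- The one-sided derivative at the end of the flat part. -/
theorem exists_tendsto_deriv : ∃ d, Tendsto (deriv H) (𝓝[>] (meanRoot γ 0)) (𝓝 d) ∧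
    HasDerivWithinAt H d (Set.Ici (meanRoot γ 0)) (meanRoot γ 0) := by
  -- Convexity beyond the flat part, together with `H' ≥ 0`, forces `H'` to converge at the edge.
  have hmono : MonotoneOn (deriv H) (Set.Ioi (meanRoot γ 0)) := by
    refine monotoneOn_of_deriv_nonneg (convex_Ioi _)
      (fun p hp => (hH.hasDerivAt_deriv hγ hp).continuousAt.continuousWithinAt) ?_ ?_ <;>
      rw [interior_Ioi] <;> intro p hp
    · exact (hH.hasDerivAt_deriv hγ hp).differentiableAt.differentiableWithinAt
    · rw [(hH.hasDerivAt_deriv hγ hp).deriv]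
      have h1 := powMean_pos hγ (α := 1 / 2) (by norm_num) (hH.pos hγ hp)
      have h2 := powMean_pos hγ (α := 3 / 2) (by norm_num) (hH.pos hγ hp)
      positivity
  have hlim := hmono.tendsto_nhdsGT ⟨0, by
    rintro _ ⟨p, hp, rfl⟩
    rw [(hH.hasDerivAt hγ hp).deriv]
    have h1 := powMean_pos hγ (α := 1 / 2) (by norm_num) (hH.pos hγ hp)
    positivity⟩
  refine ⟨_, hlim, ?_⟩
  exact hasDerivWithinAt_Ici_of_tendsto_deriv
    (fun p hp => (hH.hasDerivAt hγ hp).differentiableAt.differentiableWithinAt)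
    ((hH.continuousWithinAt hγ).mono Set.Ioi_subset_Ici_self) self_mem_nhdsWithin hlim

end IsFlatInverse

/-- Jensen's inequality for the cube. -/
theorem powMean_pow_three_le (hγ : 0 < γ) {c : ℝ} (hc : 0 < c) :
    powMean γ (1 / 2) c ^ 3 ≤ powMean γ (3 / 2) c := by
  set m := powMean γ (1 / 2) c with hm
  have hm0 : 0 < m := powMean_pos hγ (by norm_num) hc
  have hi1 := integrable_powMean_integrand hγ (α := 1 / 2) (by norm_num) hc
  have hi2 := integrable_powMean_integrand hγ (α := 3 / 2) (by norm_num) hc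
  -- Integrates the tangent line of `x ^ 3` at `m`: `f³ - 3m²f + 2m³ = (f + 2m)(f - m)² ≥ 0`.
  have h : ∫ t, (3 * m ^ 2 * (t ^ γ + c) ^ (-(1 / 2 : ℝ)) - 2 * m ^ 3) ∂torusLaw ≤
      powMean γ (3 / 2) c := by
    refine integral_mono_ae ((hi1.const_mul _).sub (integrable_const _)) hi2 ?_
    filter_upwards [ae_torusLaw_mem_Icc] with t ht
    have hX : 0 < t ^ γ + c := by have := (rpow_add_mem_Icc hγ (c := c) ht).1; linarith
    have e : (t ^ γ + c) ^ (-(3 / 2 : ℝ)) = ((t ^ γ + c) ^ (-(1 / 2 : ℝ))) ^ 3 := by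
      rw [← Real.rpow_natCast, ← Real.rpow_mul hX.le]
      norm_num
    rw [e]
    set f := (t ^ γ + c) ^ (-(1 / 2 : ℝ))
    have hf : 0 ≤ f := by positivity
    nlinarith [mul_nonneg (by positivity : 0 ≤ f + 2 * m) (sq_nonneg (f - m))]
  rw [integral_sub (hi1.const_mul _) (integrable_const _), integral_const_mul] at h
  have e : ∫ t, (t ^ γ + c) ^ (-(1 / 2 : ℝ)) ∂torusLaw = m := rfl
  rw [e] at h
  simp at h
  linarith

end

/-! ### Bounds for the quotients giving the first and second derivatives -/

namespace ComparableNearZero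

variable {A A' f g : ℝ → ℝ}

/-- Inversion swaps the roles: the global upper bound on `A` becomes a lower constant independent of
`T`, which is the source of the `M`-independent `C₁`. -/
theorem const_div (hA : ComparableNearZero A f) (hA0 : ∀ c, 0 < c → 0 < A c)
    (hf : ∀ c, 0 < c → 0 < f c) {a : ℝ} (ha : 0 < a) :
    (∃ k > 0, ∀ c, 0 < c → k * (f c)⁻¹ ≤ a / A c) ∧
      ∀ T, ∃ K > 0, ∀ c, 0 < c → c ≤ T → a / A c ≤ K * (f c)⁻¹ := by
  obtain ⟨⟨K, hK, hAK⟩, hlow⟩ := hA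
  refine ⟨⟨a / K, by positivity, fun c hc => ?_⟩, fun T => ?_⟩
  · have := hA0 c hc
    rw [← div_eq_mul_inv, div_div]
    exact div_le_div_of_nonneg_left ha.le this (hAK c hc)
  · obtain ⟨k, hk, h⟩ := hlow T
    refine ⟨a / k, by positivity, fun c hc hcT => ?_⟩
    have := hf c hc
    rw [← div_eq_mul_inv, div_div]
    exact div_le_div_of_nonneg_left ha.le (by positivity) (h c hc hcT)

/-- Each estimate mixes an upper bound of one mean with a lower bound of the other, so both
constants depend on `T`. -/
theorem div_pow_three (hA : ComparableNearZero A f) (hA' : ComparableNearZero A' g)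
    (hA0 : ∀ c, 0 < c → 0 < A c) (hf : ∀ c, 0 < c → 0 < f c) (hg : ∀ c, 0 < c → 0 < g c) (T : ℝ) :
    (∃ k > 0, ∀ c, 0 < c → c ≤ T → k * (g c / f c ^ 3) ≤ A' c / A c ^ 3) ∧
      ∃ K > 0, ∀ c, 0 < c → c ≤ T → A' c / A c ^ 3 ≤ K * (g c / f c ^ 3) := by
  obtain ⟨⟨K, hK, hAK⟩, hlow⟩ := hA
  obtain ⟨⟨K', hK', hAK'⟩, hlow'⟩ := hA'
  obtain ⟨k, hk, h⟩ := hlow T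
  obtain ⟨k', hk', h'⟩ := hlow' T
  refine ⟨⟨k' / K ^ 3, by positivity, fun c hc hcT => ?_⟩,
    ⟨K' / k ^ 3, by positivity, fun c hc hcT => ?_⟩⟩
  · have h1 := hA0 c hc
    have h2 := hg c hc
    rw [div_mul_div_comm, ← mul_pow]
    exact div_le_div₀ ((by positivity : 0 ≤ k' * g c).trans (h' c hc hcT)) (h' c hc hcT)
      (by positivity) (pow_le_pow_left₀ h1.le (hAK c hc) 3)
  · have h1 := hf c hc
    have h2 := hg c hc
    rw [div_mul_div_comm, ← mul_pow]
    exact div_le_div₀ (by positivity) (hAK' c hc) (by positivity)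
      (pow_le_pow_left₀ (by positivity) (h c hc hcT) 3)

end ComparableNearZero

section

variable {γ : ℝ} (hγ : 0 < γ)
include hγ

theorem one_le_powMean_div {c : ℝ} (hc : 0 < c) :
    1 ≤ powMean γ (3 / 2) c / powMean γ (1 / 2) c ^ 3 := by
  rw [one_le_div (pow_pos (powMean_pos hγ (by norm_num) hc) 3)]
  exact powMean_pow_three_le hγ hc

/-- For large `c` numerator and denominator both decay like `c ^ (-3/2)`: the law lives on `[0, 4]`,
and `4 ^ γ + c ≤ (4 ^ γ + 1) * c`. -/
theorem powMean_div_le {c : ℝ} (hc : 1 ≤ c) :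
    powMean γ (3 / 2) c / powMean γ (1 / 2) c ^ 3 ≤ (4 ^ γ + 1) ^ (3 / 2 : ℝ) := by
  have hc0 : 0 < c := by linarith
  have h1 := powMean_pos hγ (α := 1 / 2) (by norm_num) hc0
  rw [div_le_iff₀ (pow_pos h1 3)]
  have h2 := pow_le_pow_left₀ (by positivity) (le_powMean hγ (α := 1 / 2) (by norm_num) hc0) 3
  have h3 := powMean_le hγ (α := 3 / 2) (by norm_num) hc0
  rw [← Real.rpow_natCast, ← Real.rpow_mul (by positivity)] at h2
  norm_num at h2
  refine h3.trans (le_trans ?_ (mul_le_mul_of_nonneg_left h2 (by positivity)))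
  have h4 : (4 ^ γ + c : ℝ) ≤ (4 ^ γ + 1) * c := by
    have : (0 : ℝ) < 4 ^ γ := by positivity
    nlinarith
  have h5 : ((4 ^ γ + 1) * c : ℝ) ^ (-(3 / 2) : ℝ) ≤ (4 ^ γ + c) ^ (-(3 / 2) : ℝ) :=
    Real.rpow_le_rpow_of_nonpos (by positivity) h4 (by norm_num)
  refine le_trans (le_of_eq ?_) (mul_le_mul_of_nonneg_left h5 (by positivity))
  rw [Real.mul_rpow (by positivity) hc0.le, ← mul_assoc, ← Real.rpow_add (by positivity)]
  norm_num

/-- Beyond `c = 1` Jensen's bound replaces the local comparison and makes the constant global. -/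
theorem exists_lower_bound {h : ℝ → ℝ}
    (hloc : ∃ k > 0, ∀ c, 0 < c → c ≤ 1 →
      k * h c ≤ powMean γ (3 / 2) c / powMean γ (1 / 2) c ^ 3)
    (h0 : ∀ c, 0 < c → 0 ≤ h c) (h1 : ∀ c, 1 ≤ c → h c ≤ 1) :
    ∃ k > 0, ∀ c, 0 < c → k * h c ≤ powMean γ (3 / 2) c / powMean γ (1 / 2) c ^ 3 := by
  obtain ⟨k, hk, hloc⟩ := hloc
  refine ⟨min k 1, by positivity, fun c hc => ?_⟩
  rcases le_total c 1 with h | h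
  · exact le_trans (mul_le_mul_of_nonneg_right (min_le_left _ _) (h0 c hc)) (hloc c hc h)
  · refine le_trans ?_ (one_le_powMean_div hγ hc)
    exact (mul_le_mul (min_le_right k 1) (h1 c h) (h0 c hc) zero_le_one).trans (by norm_num)

theorem exists_upper_bound {h : ℝ → ℝ}
    (hloc : ∃ K > 0, ∀ c, 0 < c → c ≤ 1 →
      powMean γ (3 / 2) c / powMean γ (1 / 2) c ^ 3 ≤ K * h c)
    (h0 : ∀ c, 0 < c → 0 ≤ h c) (h1 : ∀ c, 1 ≤ c → 1 ≤ h c) :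
    ∃ K > 0, ∀ c, 0 < c → powMean γ (3 / 2) c / powMean γ (1 / 2) c ^ 3 ≤ K * h c := by
  obtain ⟨K, hK, hloc⟩ := hloc
  have hQ : (0 : ℝ) < (4 ^ γ + 1) ^ (3 / 2 : ℝ) := by positivity
  refine ⟨max K ((4 ^ γ + 1) ^ (3 / 2 : ℝ)), by positivity, fun c hc => ?_⟩
  rcases le_total c 1 with h | h
  · exact (hloc c hc h).trans (mul_le_mul_of_nonneg_right (le_max_left _ _) (h0 c hc))
  · refine (powMean_div_le hγ h).trans ?_
    refine (le_max_right K _).trans ?_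
    exact le_mul_of_one_le_right (by positivity) (h1 c h)

end

/-! ### Recurrence of the potential and reduction of the prototypes to `meanRoot` -/

section

variable {γ : ℝ}

/-- A bump supported near the minimum value has positive mean, so its integral cannot vanish over
long intervals, wherever they start. -/
theorem recurrent_of_hasApproxMean (hγ : 0 < γ) {v : ℝ → ℝ} (hv : Continuous v)
    (hv0 : ∀ x, 0 ≤ v x)
    (hmean : ∀ Φ : ℝ → ℝ, Continuous Φ → HasApproxMean (fun x => Φ (v x)) (∫ t, Φ t ∂torusLaw)) :
    Recurrent fun x => v x ^ γ := by
  intro δ hδ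
  set η := δ ^ (1 / γ) with hη
  have hη0 : 0 < η := by positivity
  set Φ : ℝ → ℝ := fun t => max 0 (η - t) with hΦ
  have hΦc : Continuous Φ := by fun_prop
  set m := ∫ t, Φ t ∂torusLaw with hm
  have hm0 : 0 < m := by
    have hi : Integrable Φ torusLaw := by
      refine Integrable.of_bound hΦc.aestronglyMeasurable η ?_
      filter_upwards [ae_torusLaw_mem_Icc] with t ht
      rw [Real.norm_eq_abs, abs_of_nonneg (le_max_left _ _)]
      exact max_le hη0.le (by linarith [ht.1])
    refine (integral_pos_iff_support_of_nonneg (fun t => le_max_left _ _) hi).2 ?_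
    have hsub : Set.Iio (min η 4) ⊆ Function.support Φ := fun t ht => by
      have h1 : t < η := lt_of_lt_of_le ht (min_le_left _ _)
      have h2 : 0 < Φ t := lt_of_lt_of_le (sub_pos.2 h1) (le_max_right _ _)
      exact h2.ne'
    refine lt_of_lt_of_le ?_ (measure_mono hsub)
    refine lt_of_lt_of_le ?_ (le_torusLaw_Iio (by positivity) (min_le_right _ _))
    rw [ENNReal.ofReal_pos]
    positivity
  obtain ⟨B, hB⟩ := (hmean Φ hΦc).exists_abs_integral_sub_le (hΦc.comp hv)
    (show 0 < m / 2 by positivity)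
  -- This length makes `m * L - (m / 2) * L` larger than `B`.
  refine ⟨2 * |B| / m + 1, fun x => ?_⟩
  set L := 2 * |B| / m + 1 with hL
  have hL0 : 0 < L := by positivity
  by_contra! hno
  have hzero : ∫ t in x..(x + L), Φ (v t) = 0 := by
    refine (intervalIntegral.integral_congr (g := fun _ => (0 : ℝ)) fun t ht => ?_).trans (by simp)
    rw [Set.uIcc_of_le (by linarith)] at ht
    have h1 := hno t ht.1 ht.2
    have h2 : η ≤ v t := by
      by_contra! hlt
      have h3 := Real.rpow_le_rpow (hv0 t) hlt.le hγ.le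
      rw [hη, ← Real.rpow_mul hδ.le, one_div_mul_cancel hγ.ne', Real.rpow_one] at h3
      linarith
    exact max_eq_left (by linarith)
  have h := hB x (x + L)
  rw [hzero, add_sub_cancel_left, zero_sub, abs_neg, abs_of_pos (by positivity), abs_of_pos hL0] at h
  have h1 : m * L = 2 * |B| + m := by rw [hL]; field_simp
  linarith [le_abs_self B]

end

section

variable {γ : ℝ} {U : ℝ → ℝ → ℝ} {ξ₁ ξ₂ : ℝ}

theorem isEffectiveConstant_prototype_iff (hγ : 0 < γ)
    (hU : U = sinPrototype γ ∨ U = cosPrototype γ) (hξ : NonResonant ξ₁ ξ₂) (p c : ℝ) :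
    IsEffectiveConstant (mechHamiltonian U ξ₁ ξ₂) p c ↔
      0 ≤ c ∧ |p| ≤ meanRoot γ c ∧ (0 < c → meanRoot γ c = |p|) := by
  obtain ⟨v, hv, hvI, hUv, hmean⟩ := exists_prototype_data hU hξ
  have e : mechHamiltonian U ξ₁ ξ₂ = fun x q => q ^ 2 / 2 - v (ξ₁ * x, ξ₂ * x) ^ γ := by
    funext x q
    rw [mechHamiltonian, hUv]
  have hvl : Continuous fun x : ℝ => v (ξ₁ * x, ξ₂ * x) := by fun_prop
  rw [e]
  refine isEffectiveConstant_iff (G := meanRoot γ) (K := 4 ^ γ)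
    ((Real.continuous_rpow_const hγ.le).comp hvl) (fun x => Real.rpow_nonneg (hvI _).1 _)
    (fun x => Real.rpow_le_rpow (hvI _).1 (hvI _).2 hγ.le) ?_ ?_
    (continuous_meanRoot hγ).continuousOn p c
  · exact recurrent_of_hasApproxMean hγ hvl (fun x => (hvI _).1) fun Φ hΦ => (hmean Φ hΦ).2
  · exact fun c _ => (hmean _ (continuous_meanRoot_integrand hγ c)).2

theorem criticalMomentum_prototype (hγ : 0 < γ)
    (hU : U = sinPrototype γ ∨ U = cosPrototype γ) (hξ : NonResonant ξ₁ ξ₂) :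
    criticalMomentum U = meanRoot γ 0 := by
  obtain ⟨v, hv, hvI, hUv, hmean⟩ := exists_prototype_data hU hξ
  rw [meanRoot, ← (hmean _ (continuous_meanRoot_integrand hγ 0)).1, criticalMomentum]
  simp only [hUv, add_zero]

end

/-! ### Regularity and derivative estimates of the effective Hamiltonian -/

namespace IsFlatInverse

variable {γ : ℝ} {H : ℝ → ℝ} (hH : IsFlatInverse γ H) (hγ : 0 < γ)
include hH hγ

theorem derivWithin_eq {p : ℝ} (hp : meanRoot γ 0 < p) :
    derivWithin H (Set.Ici (meanRoot γ 0)) p = √2 / powMean γ (1 / 2) (H p) := by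
  rw [derivWithin_of_mem_nhds (Ici_mem_nhds hp), (hH.hasDerivAt hγ hp).deriv]

theorem tendsto_derivWithin : Tendsto (fun p => √2 / powMean γ (1 / 2) (H p))
    (𝓝[>] (meanRoot γ 0))
    (𝓝 (derivWithin H (Set.Ici (meanRoot γ 0)) (meanRoot γ 0))) := by
  obtain ⟨d, hd, hd'⟩ := hH.exists_tendsto_deriv hγ
  rw [hd'.derivWithin (uniqueDiffWithinAt_Ici _)]
  refine hd.congr' ?_
  filter_upwards [self_mem_nhdsWithin] with p hp using (hH.hasDerivAt hγ hp).deriv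

theorem hasDerivWithinAt : HasDerivWithinAt H
    (derivWithin H (Set.Ici (meanRoot γ 0)) (meanRoot γ 0)) (Set.Ici (meanRoot γ 0))
    (meanRoot γ 0) := by
  obtain ⟨d, -, hd'⟩ := hH.exists_tendsto_deriv hγ
  exact hd'.differentiableWithinAt.hasDerivWithinAt

theorem differentiableOn : DifferentiableOn ℝ H (Set.Ici (meanRoot γ 0)) := fun p hp => by
  rcases (Set.mem_Ici.1 hp).eq_or_lt with rfl | hlt
  · exact (hH.hasDerivWithinAt hγ).differentiableWithinAt
  · exact (hH.hasDerivAt hγ hlt).differentiableAt.differentiableWithinAt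

theorem pos_and_le {p M : ℝ} (hp : p ∈ Set.Ioc (meanRoot γ 0) M) : 0 < H p ∧ H p ≤ H M :=
  ⟨hH.pos hγ hp.1, (hH.strictMonoOn hγ).monotoneOn hp.1.le (hp.1.le.trans hp.2) hp.2⟩

theorem tendsto_nhdsGT : Tendsto H (𝓝[>] (meanRoot γ 0)) (𝓝[>] 0) := by
  refine tendsto_nhdsWithin_iff.2 ⟨?_, ?_⟩
  · have h : Tendsto H (𝓝[≥] (meanRoot γ 0)) (𝓝 (H (meanRoot γ 0))) := hH.continuousWithinAt hγ
    rw [hH.apply_meanRoot hγ le_rfl] at h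
    exact h.mono_left (nhdsWithin_mono _ Set.Ioi_subset_Ici_self)
  · filter_upwards [self_mem_nhdsWithin] with p hp using hH.pos hγ hp

theorem derivWithin_eq_zero {f : ℝ → ℝ} (hf : ComparableNearZero (powMean γ (1 / 2)) f)
    (hf0 : ∀ c, 0 < c → 0 < f c) (hlim : Tendsto (fun c => (f c)⁻¹) (𝓝[>] 0) (𝓝 0)) :
    derivWithin H (Set.Ici (meanRoot γ 0)) (meanRoot γ 0) = 0 := by
  obtain ⟨K, hK, h⟩ := (hf.const_div (fun c hc => powMean_pos hγ (by norm_num) hc) hf0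
    (show 0 < √2 by positivity)).2 (H (meanRoot γ 0 + 1))
  have h1 : Tendsto (fun p => K * (f (H p))⁻¹) (𝓝[>] (meanRoot γ 0)) (𝓝 (K * 0)) :=
    (hlim.comp (hH.tendsto_nhdsGT hγ)).const_mul K
  rw [mul_zero] at h1
  refine tendsto_nhds_unique (hH.tendsto_derivWithin hγ)
    (tendsto_of_tendsto_of_tendsto_of_le_of_le' tendsto_const_nhds h1 ?_ ?_)
  · filter_upwards [self_mem_nhdsWithin] with p hp
    have := powMean_pos hγ (α := 1 / 2) (by norm_num) (hH.pos hγ hp)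
    positivity
  · filter_upwards [Ioc_mem_nhdsGT (show meanRoot γ 0 < meanRoot γ 0 + 1 by linarith)] with p hp
    exact h _ (hH.pos_and_le hγ hp).1 (hH.pos_and_le hγ hp).2

theorem contDiff_one
    (hd : derivWithin H (Set.Ici (meanRoot γ 0)) (meanRoot γ 0) = 0) : ContDiff ℝ 1 H := by
  set p₀ := meanRoot γ 0 with hp₀
  have hp₀0 : 0 < p₀ := meanRoot_zero_pos hγ
  -- `K` keeps only the right branch. By evenness `H p = K p + K (-p)`, so only one gluing point has
  -- to be treated.
  set K : ℝ → ℝ := fun p => H (max p p₀) with hK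
  set k : ℝ → ℝ := fun p => if p₀ < p then deriv H p else 0 with hk
  have hKd : ∀ p, HasDerivAt K (k p) p := fun p => by
    rcases lt_trichotomy p p₀ with hp | rfl | hp
    · simp only [hk, if_neg hp.not_gt]
      refine (hasDerivAt_const p (H p₀)).congr_of_eventuallyEq ?_
      filter_upwards [gt_mem_nhds hp] with q hq
      simp only [hK, max_eq_right (le_of_lt hq)]
    · simp only [hk, lt_irrefl, if_false]
      rw [← hasDerivWithinAt_univ, ← Set.Iic_union_Ici (a := p₀)]
      refine HasDerivWithinAt.union ?_ ?_
      · refine (hasDerivWithinAt_const p₀ _ (H p₀)).congr (fun q hq => ?_) ?_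
        · simp only [hK]; rw [max_eq_right hq]
        · simp only [hK, max_self]
      · have h := hH.hasDerivWithinAt hγ
        rw [hd] at h
        rw [← hp₀] at h
        refine h.congr (fun q hq => ?_) ?_
        · simp only [hK]; rw [max_eq_left hq]
        · simp only [hK, max_self]
    · simp only [hk, if_pos hp]
      refine ((hH.hasDerivAt hγ hp).differentiableAt.hasDerivAt).congr_of_eventuallyEq ?_
      filter_upwards [lt_mem_nhds hp] with q hq
      simp only [hK, max_eq_left (le_of_lt hq)]
  have hkc : Continuous k := by
    refine continuous_iff_continuousAt.2 fun p => ?_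
    rcases lt_trichotomy p p₀ with hp | hp | hp
    · refine (continuousAt_const (y := (0 : ℝ))).congr ?_
      filter_upwards [gt_mem_nhds hp] with q hq
      simp only [hk, if_neg (not_lt.2 (le_of_lt hq))]
    · subst hp
      have hk0 : k p₀ = 0 := by simp only [hk, lt_irrefl, if_false]
      rw [ContinuousAt, hk0, ← nhdsLE_sup_nhdsGT, tendsto_sup]
      constructor
      · refine tendsto_const_nhds.congr' ?_
        filter_upwards [self_mem_nhdsWithin] with q hq
        simp only [hk]; rw [if_neg (not_lt.2 hq)]
      · have h := hH.tendsto_derivWithin hγ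
        rw [hd, ← hp₀] at h
        refine h.congr' ?_
        filter_upwards [self_mem_nhdsWithin] with q hq
        simp only [hk]; rw [if_pos (Set.mem_Ioi.1 hq), (hH.hasDerivAt hγ hq).deriv]
    · refine (hH.hasDerivAt_deriv hγ hp).continuousAt.congr ?_
      filter_upwards [lt_mem_nhds hp] with q hq
      simp only [hk, if_pos hq]
  have hK1 : ContDiff ℝ 1 K := contDiff_one_of_hasDerivAt hKd hkc
  have hHK : H = fun p => K p + K (-p) := by
    have h0 : H p₀ = 0 := hH.apply_meanRoot hγ le_rfl
    funext p
    simp only [hK]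
    rcases le_total p p₀ with h1 | h1
    · rcases le_total (-p) p₀ with h2 | h2
      · rw [max_eq_right h1, max_eq_right h2, h0, hH.eq_zero hγ (abs_le'.2 ⟨h1, h2⟩), add_zero]
      · rw [max_eq_right h1, max_eq_left h2, h0, hH.even hγ, zero_add]
    · rw [max_eq_left h1, max_eq_right (by linarith), h0, add_zero]
  rw [hHK]
  exact hK1.add (hK1.comp contDiff_neg)

/-- The left derivative at the edge is `0` because of the flat part, and a differentiable function
must match it on the right. -/
theorem derivWithin_eq_zero_of_contDiff (h : ContDiff ℝ 1 H) :
    derivWithin H (Set.Ici (meanRoot γ 0)) (meanRoot γ 0) = 0 := by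
  have hp₀ := meanRoot_zero_pos hγ
  have hd := (h.differentiable one_ne_zero (meanRoot γ 0)).hasDerivAt
  rw [hd.hasDerivWithinAt.derivWithin (uniqueDiffWithinAt_Ici _)]
  refine (uniqueDiffWithinAt_Iic (meanRoot γ 0)).eq_deriv _ hd.hasDerivWithinAt ?_
  refine (hasDerivWithinAt_const (meanRoot γ 0) _ (0 : ℝ)).congr_of_eventuallyEq ?_ ?_
  · filter_upwards [self_mem_nhdsWithin,
      nhdsWithin_le_nhds (lt_mem_nhds (show -meanRoot γ 0 < meanRoot γ 0 by linarith))] with p h1 h2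
    exact hH.eq_zero hγ (abs_le.2 ⟨le_of_lt h2, h1⟩)
  · exact hH.eq_zero hγ (abs_of_pos hp₀).le

/-- The second derivative is `0` left of the edge and at least `1` right of it by Jensen, whatever
`γ` is. -/
theorem not_contDiff_two : ¬ ContDiff ℝ 2 H := by
  intro h
  have hp₀ := meanRoot_zero_pos hγ
  rw [show (2 : WithTop ℕ∞) = 1 + 1 from rfl, contDiff_succ_iff_deriv] at h
  have hc : Continuous (deriv (deriv H)) := h.2.2.continuous_deriv le_rfl
  have h1 : 1 ≤ deriv (deriv H) (meanRoot γ 0) := by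
    refine ge_of_tendsto ((hc.tendsto _).mono_left (nhdsWithin_le_nhds (s := Set.Ioi (meanRoot γ 0)))) ?_
    filter_upwards [self_mem_nhdsWithin] with p hp
    rw [(hH.hasDerivAt_deriv hγ hp).deriv]
    exact one_le_powMean_div hγ (hH.pos hγ hp)
  have h2 : deriv (deriv H) (meanRoot γ 0) ≤ 0 := by
    refine le_of_tendsto ((hc.tendsto _).mono_left (nhdsWithin_le_nhds (s := Set.Iio (meanRoot γ 0)))) ?_
    filter_upwards [Ioo_mem_nhdsLT (show -meanRoot γ 0 < meanRoot γ 0 by linarith)] with p hp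
    have hd : ∀ q ∈ Set.Ioo (-meanRoot γ 0) (meanRoot γ 0), deriv H q = 0 := fun q hq => by
      have : H =ᶠ[𝓝 q] fun _ => 0 := by
        filter_upwards [Ioo_mem_nhds hq.1 hq.2] with r hr
        exact hH.eq_zero hγ (abs_le.2 ⟨hr.1.le, hr.2.le⟩)
      rw [this.deriv_eq, deriv_const]
    have : deriv H =ᶠ[𝓝 p] fun _ => 0 := by
      filter_upwards [Ioo_mem_nhds hp.1 hp.2] with r hr using hd r hr
    rw [this.deriv_eq, deriv_const]
  linarith

theorem derivWithin_bounds {f : ℝ → ℝ} (hf : ComparableNearZero (powMean γ (1 / 2)) f)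
    (hf0 : ∀ c, 0 < c → 0 < f c) : ∃ C₁ > 0, ∀ M : ℝ, ∃ C₂ > 0,
      ∀ p ∈ Set.Ioc (meanRoot γ 0) M,
        C₁ * (f (H p))⁻¹ ≤ derivWithin H (Set.Ici (meanRoot γ 0)) p ∧
        derivWithin H (Set.Ici (meanRoot γ 0)) p ≤ C₂ * (f (H p))⁻¹ := by
  obtain ⟨⟨k, hk, h1⟩, h2⟩ := hf.const_div (fun c hc => powMean_pos hγ (by norm_num) hc) hf0
    (show 0 < √2 by positivity)
  refine ⟨k, hk, fun M => ?_⟩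
  obtain ⟨K, hK, h3⟩ := h2 (H M)
  refine ⟨K, hK, fun p hp => ?_⟩
  rw [hH.derivWithin_eq hγ hp.1]
  exact ⟨h1 _ (hH.pos hγ hp.1), h3 _ (hH.pos hγ hp.1) (hH.pos_and_le hγ hp).2⟩

theorem deriv_deriv_bounds_local {f g : ℝ → ℝ} (hf : ComparableNearZero (powMean γ (1 / 2)) f)
    (hg : ComparableNearZero (powMean γ (3 / 2)) g)
    (hf0 : ∀ c, 0 < c → 0 < f c) (hg0 : ∀ c, 0 < c → 0 < g c) (M : ℝ) :
    (∃ C₁ > 0, ∀ p ∈ Set.Ioc (meanRoot γ 0) M,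
      C₁ * (g (H p) / f (H p) ^ 3) ≤ deriv (deriv H) p) ∧
    ∃ C₂ > 0, ∀ p ∈ Set.Ioc (meanRoot γ 0) M,
      deriv (deriv H) p ≤ C₂ * (g (H p) / f (H p) ^ 3) := by
  obtain ⟨⟨k, hk, h1⟩, K, hK, h2⟩ := hf.div_pow_three hg
    (fun c hc => powMean_pos hγ (by norm_num) hc) hf0 hg0 (H M)
  refine ⟨⟨k, hk, fun p hp => ?_⟩, K, hK, fun p hp => ?_⟩ <;>
    rw [(hH.hasDerivAt_deriv hγ hp.1).deriv]
  · exact h1 _ (hH.pos hγ hp.1) (hH.pos_and_le hγ hp).2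
  · exact h2 _ (hH.pos hγ hp.1) (hH.pos_and_le hγ hp).2

theorem le_deriv_deriv {f g : ℝ → ℝ} (hf : ComparableNearZero (powMean γ (1 / 2)) f)
    (hg : ComparableNearZero (powMean γ (3 / 2)) g)
    (hf0 : ∀ c, 0 < c → 0 < f c) (hg0 : ∀ c, 0 < c → 0 < g c)
    (h1 : ∀ c, 1 ≤ c → g c / f c ^ 3 ≤ 1) :
    ∃ C₁ > 0, ∀ p ∈ Set.Ioi (meanRoot γ 0),
      C₁ * (g (H p) / f (H p) ^ 3) ≤ deriv (deriv H) p := by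
  obtain ⟨k, hk, h⟩ := exists_lower_bound hγ (hf.div_pow_three hg
    (fun c hc => powMean_pos hγ (by norm_num) hc) hf0 hg0 1).1
    (fun c hc => by have := hf0 c hc; have := hg0 c hc; positivity) h1
  refine ⟨k, hk, fun p hp => ?_⟩
  rw [(hH.hasDerivAt_deriv hγ hp).deriv]
  exact h _ (hH.pos hγ hp)

theorem deriv_deriv_le {f g : ℝ → ℝ} (hf : ComparableNearZero (powMean γ (1 / 2)) f)
    (hg : ComparableNearZero (powMean γ (3 / 2)) g)
    (hf0 : ∀ c, 0 < c → 0 < f c) (hg0 : ∀ c, 0 < c → 0 < g c)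
    (h1 : ∀ c, 1 ≤ c → 1 ≤ g c / f c ^ 3) :
    ∃ C₂ > 0, ∀ p ∈ Set.Ioi (meanRoot γ 0),
      deriv (deriv H) p ≤ C₂ * (g (H p) / f (H p) ^ 3) := by
  obtain ⟨k, hk, h⟩ := exists_upper_bound hγ (hf.div_pow_three hg
    (fun c hc => powMean_pos hγ (by norm_num) hc) hf0 hg0 1).2
    (fun c hc => by have := hf0 c hc; have := hg0 c hc; positivity) h1
  refine ⟨k, hk, fun p hp => ?_⟩
  rw [(hH.hasDerivAt_deriv hγ hp).deriv]
  exact h _ (hH.pos hγ hp)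

theorem deriv_deriv_bounds {f g : ℝ → ℝ} (hf : ComparableNearZero (powMean γ (1 / 2)) f)
    (hg : ComparableNearZero (powMean γ (3 / 2)) g)
    (hf0 : ∀ c, 0 < c → 0 < f c) (hg0 : ∀ c, 0 < c → 0 < g c)
    (h1 : ∀ c, 1 ≤ c → g c / f c ^ 3 ≤ 1) :
    ∃ C₁ > 0, ∀ M : ℝ, ∃ C₂ > 0, ∀ p ∈ Set.Ioc (meanRoot γ 0) M,
      C₁ * (g (H p) / f (H p) ^ 3) ≤ deriv (deriv H) p ∧
      deriv (deriv H) p ≤ C₂ * (g (H p) / f (H p) ^ 3) := by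
  obtain ⟨k, hk, h⟩ := hH.le_deriv_deriv hγ hf hg hf0 hg0 h1
  refine ⟨k, hk, fun M => ?_⟩
  obtain ⟨K, hK, h'⟩ := (hH.deriv_deriv_bounds_local hγ hf hg hf0 hg0 M).2
  exact ⟨K, hK, fun p hp => ⟨h p hp.1, h' p hp⟩⟩

end IsFlatInverse

/-! ### Logarithmic comparisons and the case analysis in `γ` -/

theorem tendsto_inv_one_add_abs_log : Tendsto (fun c : ℝ => (1 + |Real.log c|)⁻¹) (𝓝[>] 0) (𝓝 0) :=
  tendsto_inv_atTop_zero.comp (tendsto_atTop_add_const_left _ _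
    (tendsto_abs_atBot_atTop.comp Real.tendsto_log_nhdsGT_zero))

theorem abs_log_comparable {T c : ℝ} (hT : T < 1) (hc : 0 < c) (hcT : c ≤ T) :
    0 < |Real.log T| ∧ |Real.log T| ≤ |Real.log c| := by
  have h1 := Real.log_neg (hc.trans_le hcT) hT
  have h2 := Real.log_le_log hc hcT
  rw [abs_of_neg h1, abs_of_neg (h2.trans_lt h1)]
  constructor <;> linarith

/-- Replacing `1 + |log c|` by `|log c|` away from `c = 1`. -/
theorem one_add_abs_log_le {T c : ℝ} (hT : T < 1) (hc : 0 < c) (hcT : c ≤ T) :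
    1 + |Real.log c| ≤ (1 + |Real.log T|⁻¹) * |Real.log c| := by
  obtain ⟨h1, h2⟩ := abs_log_comparable hT hc hcT
  have : 1 ≤ |Real.log T|⁻¹ * |Real.log c| := by
    rw [inv_mul_eq_div, one_le_div h1]; exact h2
  linarith

/- The derivative of `Hbar` at `p ≥ p₀` is written `derivWithin Hbar (Set.Ici p₀) p`: it is the
usual derivative for `p > p₀` and the right derivative at `p = p₀`. -/
theorem mainTheorem7 (γ : ℝ) (hγ : 0 < γ)
    (U : ℝ → ℝ → ℝ) (hU : U = sinPrototype γ ∨ U = cosPrototype γ)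
    (ξ₁ ξ₂ : ℝ) (hξ : NonResonant ξ₁ ξ₂)
    (Hbar : ℝ → ℝ) (hHbar : Hbar = effectiveHamiltonian (mechHamiltonian U ξ₁ ξ₂))
    (p₀ : ℝ) (hp₀ : p₀ = criticalMomentum U) :
    -- `Hbar` is well defined
    (∀ p : ℝ, ∃! c : ℝ, IsEffectiveConstant (mechHamiltonian U ξ₁ ξ₂) p c) ∧
    -- (i)
    ((ContDiff ℝ 1 Hbar ↔ 2 ≤ γ) ∧
      DifferentiableOn ℝ Hbar (Set.Ici p₀) ∧
      (2 < γ → ∃ C₁ > 0, ∀ M : ℝ, ∃ C₂ > 0, ∀ p ∈ Set.Icc p₀ M,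
        C₁ * Hbar p ^ (1 / 2 - 1 / γ) ≤ derivWithin Hbar (Set.Ici p₀) p ∧
        derivWithin Hbar (Set.Ici p₀) p ≤ C₂ * Hbar p ^ (1 / 2 - 1 / γ)) ∧
      (γ = 2 →
        derivWithin Hbar (Set.Ici p₀) p₀ = 0 ∧
        (∃ C₁ > 0, ∀ M : ℝ, ∃ C₂ > 0, ∀ p ∈ Set.Ioc p₀ M,
          C₁ * (1 + |Real.log (Hbar p)|)⁻¹ ≤ derivWithin Hbar (Set.Ici p₀) p ∧
          derivWithin Hbar (Set.Ici p₀) p ≤ C₂ * (1 + |Real.log (Hbar p)|)⁻¹) ∧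
        (∀ M : ℝ, Hbar M < 1 → ∃ C₁ > 0, ∃ C₂ > 0, ∀ p ∈ Set.Ioc p₀ M,
          C₁ * |Real.log (Hbar p)|⁻¹ ≤ derivWithin Hbar (Set.Ici p₀) p ∧
          derivWithin Hbar (Set.Ici p₀) p ≤ C₂ * |Real.log (Hbar p)|⁻¹)) ∧
      (γ < 2 → ∃ C₁ > 0, ∀ M : ℝ, ∃ C₂ > 0, ∀ p ∈ Set.Icc p₀ M,
        C₁ ≤ derivWithin Hbar (Set.Ici p₀) p ∧ derivWithin Hbar (Set.Ici p₀) p ≤ C₂)) ∧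
    -- (ii)
    (¬ ContDiff ℝ 2 Hbar ∧
      ContDiffOn ℝ 2 Hbar (Set.Ioi p₀) ∧
      (2 < γ → ∃ C₁ > 0, ∀ M : ℝ, ∃ C₂ > 0, ∀ p ∈ Set.Ioc p₀ M,
        C₁ * Hbar p ^ (-(2 / γ)) ≤ deriv (deriv Hbar) p ∧
        deriv (deriv Hbar) p ≤ C₂ * Hbar p ^ (-(2 / γ))) ∧
      (γ = 2 →
        (∃ C₁ > 0, ∀ M : ℝ, ∃ C₂ > 0, ∀ p ∈ Set.Ioc p₀ M,
          C₁ * (Hbar p * (1 + |Real.log (Hbar p)|) ^ 3)⁻¹ ≤ deriv (deriv Hbar) p ∧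
          deriv (deriv Hbar) p ≤ C₂ * (Hbar p * (1 + |Real.log (Hbar p)|) ^ 3)⁻¹) ∧
        (∀ M : ℝ, Hbar M < 1 → ∃ C₁ > 0, ∃ C₂ > 0, ∀ p ∈ Set.Ioc p₀ M,
          C₁ * (Hbar p * |Real.log (Hbar p)| ^ 3)⁻¹ ≤ deriv (deriv Hbar) p ∧
          deriv (deriv Hbar) p ≤ C₂ * (Hbar p * |Real.log (Hbar p)| ^ 3)⁻¹)) ∧
      (2 / 3 < γ → γ < 2 → ∃ C₁ > 0, ∀ M : ℝ, ∃ C₂ > 0, ∀ p ∈ Set.Ioc p₀ M,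
        C₁ * Hbar p ^ (1 / γ - 3 / 2) ≤ deriv (deriv Hbar) p ∧
        deriv (deriv Hbar) p ≤ C₂ * Hbar p ^ (1 / γ - 3 / 2)) ∧
      (γ = 2 / 3 → ∃ C₂ > 0, ∀ M : ℝ, ∃ C₁ > 0, ∀ p ∈ Set.Ioc p₀ M,
        C₁ * (1 + |Real.log (Hbar p)|) ≤ deriv (deriv Hbar) p ∧
        deriv (deriv Hbar) p ≤ C₂ * (1 + |Real.log (Hbar p)|)) ∧
      (γ < 2 / 3 → ∃ C₁ > 0, ∃ C₂ > 0, ∀ p ∈ Set.Ioi p₀,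
        C₁ ≤ deriv (deriv Hbar) p ∧ deriv (deriv Hbar) p ≤ C₂)) := by

  have hiff := isEffectiveConstant_prototype_iff hγ hU hξ
  have hex : ∀ p : ℝ, ∃! c : ℝ, IsEffectiveConstant (mechHamiltonian U ξ₁ ξ₂) p c := fun p => by
    simp only [hiff]
    exact existsUnique_effective hγ p
  -- Existence of the constant ensures that `epsilon` picks a genuine solution, never its arbitrary
  -- value.
  have hH : IsFlatInverse γ Hbar := fun p => by
    rw [← hiff, hHbar]
    exact Classical.epsilon_spec (hex p).exists
  rw [criticalMomentum_prototype hγ hU hξ] at hp₀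
  subst hp₀
  have h12 : (0 : ℝ) < 1 / 2 := by norm_num
  have h32 : (0 : ℝ) < 3 / 2 := by norm_num
  have hrpow : ∀ r c : ℝ, 0 < c → 0 < c ^ r := fun r c hc => Real.rpow_pos_of_pos hc r
  have hlogpos : ∀ c : ℝ, 0 < c → 0 < 1 + |Real.log c| := fun c _ => by positivity
  have hone : ∀ c : ℝ, 0 < c → (0 : ℝ) < 1 := fun _ _ => one_pos
  have hH0 : Hbar (meanRoot γ 0) = 0 := hH.apply_meanRoot hγ le_rfl
  have hflat2 : 2 < γ → derivWithin Hbar (Set.Ici (meanRoot γ 0)) (meanRoot γ 0) = 0 := fun h => by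
    have hexp : 0 < 1 / 2 - 1 / γ := by
      have := one_div_lt_one_div_of_lt two_pos h
      linarith
    refine hH.derivWithin_eq_zero hγ
      (powMean_comparableNearZero_of_one_lt hγ h12 (by linarith)) (hrpow _) ?_
    have hc : Tendsto (fun c : ℝ => c ^ (1 / 2 - 1 / γ)) (𝓝 0) (𝓝 (0 ^ (1 / 2 - 1 / γ))) :=
      (Real.continuous_rpow_const hexp.le).tendsto 0
    rw [Real.zero_rpow hexp.ne'] at hc
    refine (hc.mono_left nhdsWithin_le_nhds).congr' ?_
    filter_upwards [self_mem_nhdsWithin] with c hc0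
    rw [← Real.rpow_neg (le_of_lt hc0), neg_sub]
  have hflat : γ = 2 → derivWithin Hbar (Set.Ici (meanRoot γ 0)) (meanRoot γ 0) = 0 := fun h =>
    hH.derivWithin_eq_zero hγ (powMean_comparableNearZero_of_eq_one hγ h12 (by rw [h]; norm_num))
      hlogpos tendsto_inv_one_add_abs_log
  have hsub2 : γ < 2 → ∃ C₁ > 0, ∀ M : ℝ, ∃ C₂ > 0, ∀ p ∈ Set.Icc (meanRoot γ 0) M,
      C₁ ≤ derivWithin Hbar (Set.Ici (meanRoot γ 0)) p ∧
      derivWithin Hbar (Set.Ici (meanRoot γ 0)) p ≤ C₂ := fun h => by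
    obtain ⟨C₁, hC₁, hb⟩ := hH.derivWithin_bounds hγ
      (powMean_comparableNearZero_of_lt_one hγ h12 (by linarith)) hone
    refine ⟨C₁, hC₁, fun M => ?_⟩
    -- Enlarging `M` leaves points to the right of the edge even when `M` is the edge itself, so the
    -- bounds pass to the limit there.
    obtain ⟨C₂, hC₂, hb⟩ := hb (M + 1)
    simp only [inv_one, mul_one] at hb
    refine ⟨C₂, hC₂, fun p hp => ?_⟩
    rcases hp.1.eq_or_lt with rfl | hlt
    · have hlim := hH.tendsto_derivWithin hγ
      have hev : ∀ᶠ p in 𝓝[>] (meanRoot γ 0), C₁ ≤ √2 / powMean γ (1 / 2) (Hbar p) ∧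
          √2 / powMean γ (1 / 2) (Hbar p) ≤ C₂ := by
        filter_upwards [Ioc_mem_nhdsGT (show meanRoot γ 0 < M + 1 by linarith [hp.2])] with q hq
        rw [← hH.derivWithin_eq hγ hq.1]
        exact hb q hq
      exact ⟨ge_of_tendsto hlim (hev.mono fun _ h => h.1),
        le_of_tendsto hlim (hev.mono fun _ h => h.2)⟩
    · exact hb p ⟨hlt, by linarith [hp.2]⟩
  refine ⟨hex, ⟨⟨fun h => ?_, fun h => ?_⟩, hH.differentiableOn hγ, fun h => ?_, fun h => ?_, hsub2⟩,
    hH.not_contDiff_two hγ, hH.contDiffOn hγ, fun h => ?_, fun h => ?_, fun h h' => ?_,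
    fun h => ?_, fun h => ?_⟩
  · by_contra! hlt
    obtain ⟨C₁, hC₁, hb⟩ := hsub2 hlt
    obtain ⟨C₂, -, hb'⟩ := hb (meanRoot γ 0)
    have h1 := (hb' _ ⟨le_rfl, le_rfl⟩).1
    rw [hH.derivWithin_eq_zero_of_contDiff hγ h] at h1
    linarith
  · refine hH.contDiff_one hγ ?_
    rcases h.lt_or_eq with h | h
    · exact hflat2 h
    · exact hflat h.symm
  · have hexp : 0 < 1 / 2 - 1 / γ := by
      have := one_div_lt_one_div_of_lt two_pos h
      linarith
    obtain ⟨C₁, hC₁, hb⟩ := hH.derivWithin_bounds hγ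
      (powMean_comparableNearZero_of_one_lt hγ h12 (by linarith)) (hrpow _)
    refine ⟨C₁, hC₁, fun M => ?_⟩
    obtain ⟨C₂, hC₂, hb⟩ := hb M
    refine ⟨C₂, hC₂, fun p hp => ?_⟩
    rcases hp.1.eq_or_lt with rfl | hlt
    -- At the edge both sides vanish, since the exponent is positive.
    · rw [hH0, Real.zero_rpow hexp.ne', hflat2 h]
      simp
    · have := hb p ⟨hlt, hp.2⟩
      rwa [← Real.rpow_neg (hH p).1, neg_sub] at this
  · have hcomp := powMean_comparableNearZero_of_eq_one hγ h12 (by rw [h]; norm_num)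
    obtain ⟨C₁, hC₁, hb⟩ := hH.derivWithin_bounds hγ hcomp hlogpos
    refine ⟨hflat h, ⟨C₁, hC₁, hb⟩, fun M hM => ?_⟩
    obtain ⟨C₂, hC₂, hb⟩ := hb M
    -- `1 + |log c| ≤ D * |log c|` for `0 < c ≤ Hbar M < 1`. If `Hbar M = 0`, then `D = 1` by
    -- convention and the range of `p` is empty.
    set D := 1 + |Real.log (Hbar M)|⁻¹ with hD
    have hD0 : 0 < D := by positivity
    refine ⟨C₁ / D, by positivity, C₂, hC₂, fun p hp => ?_⟩
    obtain ⟨hp0, hpM⟩ := hH.pos_and_le hγ hp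
    obtain ⟨hl, hl'⟩ := abs_log_comparable hM hp0 hpM
    have hl0 := hl.trans_le hl'
    have hle := one_add_abs_log_le hM hp0 hpM
    obtain ⟨b1, b2⟩ := hb p hp
    constructor
    · refine le_trans ?_ b1
      rw [div_mul_eq_mul_div, mul_div_assoc]
      refine mul_le_mul_of_nonneg_left ?_ hC₁.le
      rw [div_eq_mul_inv, ← mul_inv]
      refine inv_anti₀ (by positivity) ?_
      rwa [mul_comm _ D]
    · refine b2.trans (mul_le_mul_of_nonneg_left ?_ hC₂.le)
      exact inv_anti₀ hl0 (by linarith)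
  · have key := hH.deriv_deriv_bounds hγ
      (powMean_comparableNearZero_of_one_lt hγ h12 (by linarith))
      (powMean_comparableNearZero_of_one_lt hγ h32 (by linarith)) (hrpow _) (hrpow _)
    -- The exponents combine as `(1/γ - 3/2) - 3 (1/γ - 1/2) = -2/γ`.
    have e : ∀ c : ℝ, 0 < c →
        c ^ (1 / γ - 3 / 2) / (c ^ (1 / γ - 1 / 2)) ^ 3 = c ^ (-(2 / γ)) := fun c hc => by
      rw [← Real.rpow_natCast, ← Real.rpow_mul hc.le, ← Real.rpow_sub hc]
      congr 1
      push_cast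
      ring
    obtain ⟨C₁, hC₁, hb⟩ := key fun c hc => by
      rw [e c (by linarith)]
      exact Real.rpow_le_one_of_one_le_of_nonpos hc (neg_nonpos.2 (by positivity))
    refine ⟨C₁, hC₁, fun M => ?_⟩
    obtain ⟨C₂, hC₂, hb⟩ := hb M
    refine ⟨C₂, hC₂, fun p hp => ?_⟩
    have := hb p hp
    rwa [e _ (hH.pos hγ hp.1)] at this
  · have hcomp := powMean_comparableNearZero_of_eq_one hγ h12 (by rw [h]; norm_num)
    have hcomp' := powMean_comparableNearZero_of_one_lt hγ h32 (by rw [h]; norm_num)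
    have e : ∀ c : ℝ, c ^ (1 / γ - 3 / 2) / (1 + |Real.log c|) ^ 3 =
        (c * (1 + |Real.log c|) ^ 3)⁻¹ := fun c => by
      rw [h, show (1 / 2 - 3 / 2 : ℝ) = -1 by norm_num, Real.rpow_neg_one, mul_inv, div_eq_mul_inv]
    have key := hH.deriv_deriv_bounds hγ hcomp hcomp' hlogpos (hrpow _)
    simp only [e] at key
    obtain ⟨C₁, hC₁, hb⟩ := key fun c hc => by
      refine inv_le_one_of_one_le₀ (one_le_mul_of_one_le_of_one_le hc (one_le_pow₀ ?_))
      linarith [abs_nonneg (Real.log c)]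
    refine ⟨⟨C₁, hC₁, hb⟩, fun M hM => ?_⟩
    obtain ⟨C₂, hC₂, hb⟩ := hb M
    set D := 1 + |Real.log (Hbar M)|⁻¹ with hD
    have hD0 : 0 < D := by positivity
    refine ⟨C₁ / D ^ 3, by positivity, C₂, hC₂, fun p hp => ?_⟩
    obtain ⟨hp0, hpM⟩ := hH.pos_and_le hγ hp
    obtain ⟨hl, hl'⟩ := abs_log_comparable hM hp0 hpM
    have hl0 := hl.trans_le hl'
    have hle := one_add_abs_log_le hM hp0 hpM
    obtain ⟨b1, b2⟩ := hb p hp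
    constructor
    · refine le_trans ?_ b1
      rw [div_mul_eq_mul_div, mul_div_assoc]
      refine mul_le_mul_of_nonneg_left ?_ hC₁.le
      rw [div_eq_mul_inv, ← mul_inv]
      refine inv_anti₀ (by positivity) ?_
      rw [mul_assoc, ← mul_pow, mul_comm _ D]
      gcongr
    · refine b2.trans (mul_le_mul_of_nonneg_left ?_ hC₂.le)
      refine inv_anti₀ (by positivity) ?_
      gcongr
      linarith
  · have hexp : 1 / γ - 3 / 2 < 0 := by
      have := one_div_lt_one_div_of_lt (by norm_num : (0 : ℝ) < 2 / 3) h
      norm_num at this ⊢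
      linarith
    have key := hH.deriv_deriv_bounds hγ
      (powMean_comparableNearZero_of_lt_one hγ h12 (by linarith))
      (powMean_comparableNearZero_of_one_lt hγ h32 (by linarith)) hone (hrpow _)
    simp only [one_pow, div_one] at key
    exact key fun c hc => Real.rpow_le_one_of_one_le_of_nonpos hc hexp.le
  · have hf := powMean_comparableNearZero_of_lt_one hγ h12 (by rw [h]; norm_num)
    have hg := powMean_comparableNearZero_of_eq_one hγ h32 (by rw [h]; norm_num)
    -- Only the upper constant is global: for large `c` the second derivative stays bounded while `1
    -- + |log c|` grows, so the lower one must depend on `M`.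
    obtain ⟨C₂, hC₂, hb⟩ := hH.deriv_deriv_le hγ hf hg hone hlogpos fun c _ => by
      simp only [one_pow, div_one]
      linarith [abs_nonneg (Real.log c)]
    refine ⟨C₂, hC₂, fun M => ?_⟩
    obtain ⟨C₁, hC₁, hb'⟩ := (hH.deriv_deriv_bounds_local hγ hf hg hone hlogpos M).1
    simp only [one_pow, div_one] at hb hb'
    exact ⟨C₁, hC₁, fun p hp => ⟨hb' p hp, hb p hp.1⟩⟩
  · have hf := powMean_comparableNearZero_of_lt_one hγ h12 (by linarith)
    have hg := powMean_comparableNearZero_of_lt_one hγ h32 (by linarith)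
    -- The comparison quotient is identically `1`, so it meets the requirement for `c ≥ 1` in both
    -- directions and both constants are global.
    obtain ⟨C₁, hC₁, hb⟩ := hH.le_deriv_deriv hγ hf hg hone hone fun c _ => by norm_num
    obtain ⟨C₂, hC₂, hb'⟩ := hH.deriv_deriv_le hγ hf hg hone hone fun c _ => by norm_num
    simp only [one_pow, div_one, mul_one] at hb hb'
    exact ⟨C₁, hC₁, C₂, hC₂, fun p hp => ⟨hb p hp, hb' p hp⟩⟩
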